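/- Let $\alpha,\beta\in\mathbb C$ with $\operatorname{Re}\alpha>-\tfrac12$ and $\alpha+\beta,\ \alpha-\beta\notin\{-1,-2,\dots\}$. Contour. Let $\Gamma_1,\dots,\Gamma_8$ be the rays from $0$ with directions $\arg\zeta=\theta_k$, where $\theta_1=\frac{\pi}{2}$, $\theta_3=\pi$, $\theta_5=\frac{3\pi}2$, $\theta_7=0$ and $\theta_2\in(\frac\pi2,\pi)$, $\theta_4\in(\pi,\frac{3\pi}2)$, $\theta_6\in(\frac{3\pi}2,2\pi)$, $\theta_8\in(0,\frac\pi2)$ are arbitrary. Orient $\Gamma_1,\Gamma_2,\Gamma_3,\Gamma_7,\Gamma_8$ away from $0$ and $\Gamma_4,\Gamma_5,\Gamma_6$ towards $0$; the $+$ side is on the left, the $-$ side on the right. Let I, II, …, VII, VIII be the open sectors between $\Gamma_1$ and $\Gamma_2$, $\Gamma_2$ and $\Gamma_3$, …, $\Gamma_7$ and $\Gamma_8$, $\Gamma_8$ and $\Gamma_1$. The sectors II, III, VI, VII are said to be outside the lenses. Jump matrices. $$J_1=\begin{pmatrix}0&e^{-i\pi\beta}\\-e^{i\pi\beta}&0\end{pmatrix},\quad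 J_5=\begin{pmatrix}0&e^{i\pi\beta}\\-e^{-i\pi\beta}&0\end{pmatrix},\quad J_3=J_7=\begin{pmatrix}e^{i\pi\alpha}&0\\0&e^{-i\pi\alpha}\end{pmatrix},$$ $$J_2=\begin{pmatrix}1&0\\e^{i\pi(\beta-2\alpha)}&1\end{pmatrix},\quad J_4=\begin{pmatrix}1&0\\e^{-i\pi(\beta-2\alpha)}&1\end{pmatrix},\quad J_8=\begin{pmatrix}1&0\\e^{i\pi(\beta+2\alpha)}&1\end{pmatrix},\quad J_6=\begin{pmatrix}1&0\\e^{-i\pi(\beta+2\alpha)}&1\end{pmatrix}.$$ Riemann–Hilbert problem. Find a $2\times2$ matrix-valued function $\Psi$ such that (a) $\Psi$ is analytic in $\mathbb C\setminus\bigcup_{k=1}^8\Gamma_k$ (the rays include $0$); (b) at every point of $\Gamma_k\setminus\{0\}$, $k=1,\dots,8$, the boundary values $\Psi_\pm$ from the two sides exist and $\Psi_+=\Psi_-J_k$; (c) as $\zeta\to0$ in each sector outside the lenses, $$\Psi(\zeta)=\begin{pmatrix}O(\zeta^{\alpha})&O(\zeta^{\alpha})+O(\zeta^{-\alpha})\\O(\zeta^{\alpha})&O(\zeta^{\alpha})+O(\zeta^{-\alpha})\end{pmatrix}\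 \text{ if }\alpha\ne0,\qquad \Psi(\zeta)=\begin{pmatrix}O(1)&O(\ln|\zeta|)\\O(1)&O(\ln|\zeta|)\end{pmatrix}\ \text{ if }\alpha=0,\ \beta\neq0,$$ and in the other sectors the behaviour is the one obtained from this by the jump conditions, that is, as $\zeta\to0$ in I, IV, V, VIII, the same estimates hold for $\Psi J_2$, $\Psi J_4$, $\Psi J_6^{-1}$, $\Psi J_8^{-1}$ respectively. Here $O(a)$ means $O(|a|)$. Let $\psi(a,c,x)$ be the Tricomi confluent hypergeometric function on the universal covering of $\mathbb C\setminus\{0\}$: for $c\notin\mathbb Z$, $$\psi(a,c,x)=\frac{\Gamma(1-c)}{\Gamma(1+a-c)}M(a,c,x)+\frac{\Gamma(c-1)}{\Gamma(a)}x^{1-c}M(1+a-c,2-c,x),\qquad M(a,c,x)=\sum_{n\ge0}\frac{(a)_n}{(c)_n}\frac{x^n}{n!},$$ and for $c\in\mathbb Z$ it is defined by continuity in $c$. Here $1/\Gamma=0$ at the poles of $\Gamma$. All functions of $\zeta$ below are taken on the branch $0<\arg\zeta<2\pi$ (so that $e^{-i\pi}\zeta$ has argument in $(-\pi,\pi)$).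 Then a solution of the problem (a)–(c) is given in the sector I by $$\Psi^{(I)}(\zeta)=\begin{pmatrix}\zeta^{\alpha}\psi(\alpha+\beta,1+2\alpha,\zeta)e^{i\pi(2\beta+\alpha)}e^{-\zeta/2}&-\zeta^{\alpha}\psi(1+\alpha-\beta,1+2\alpha,e^{-i\pi}\zeta)e^{i\pi(\beta+\alpha)}e^{\zeta/2}\frac{\Gamma(1+\alpha-\beta)}{\Gamma(\alpha+\beta)}\\-\zeta^{-\alpha}\psi(1-\alpha+\beta,1-2\alpha,\zeta)e^{i\pi(\beta-3\alpha)}e^{-\zeta/2}\frac{\Gamma(1+\alpha+\beta)}{\Gamma(\alpha-\beta)}&\zeta^{-\alpha}\psi(-\alpha-\beta,1-2\alpha,e^{-i\pi}\zeta)e^{-i\pi\alpha}e^{\zeta/2}\end{pmatrix}$$ and in the other sectors by successive application of the jump conditions to the analytic continuation of $\Psi^{(I)}$ to $0<\arg\zeta<2\pi$: $\Psi$ equals $\Psi^{(I)}$ multiplied on the right by $J_2$ in II, $J_2J_3$ in III, $J_2J_3J_4^{-1}$ in IV, $J_2J_3J_4^{-1}J_5^{-1}$ in V, $J_2J_3J_4^{-1}J_5^{-1}J_6^{-1}$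 in VI, $J_1^{-1}$ in VIII and $J_1^{-1}J_8^{-1}$ in VII. -/

import Mathlib

open Filter Topology Asymptotics

noncomputable section

namespace FisherHartwig

/-! ### Confluent hypergeometric functions -/

/-- Kummer's function `M(a,c,x) = ∑ₙ (a)ₙ / (c)ₙ * xⁿ / n!`, for `c ∉ {0,-1,-2,…}`; it is `Γ(c)`
times the regularized hypergeometric function `₁F₁`. -/
def kummerM (a c x : ℂ) : ℂ :=
  Complex.Gamma c * Complex.regularizedHGFun {a} {c} x

/-- Tricomi's function for non-integer `c`, at the point `x = exp w` of the universal covering of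
the punctured plane:
`Γ(1-c)/Γ(1+a-c) M(a,c,x) + Γ(c-1)/Γ(a) x^(1-c) M(1+a-c,2-c,x)`, with `x^(1-c) = exp((1-c)w)`.
(At the poles of `Γ`, Mathlib has `Γ = 0`, so that `1/Γ` has there its correct value `0`.) -/
def tricomiGeneric (a c w : ℂ) : ℂ :=
  Complex.Gamma (1 - c) / Complex.Gamma (1 + a - c) * kummerM a c (Complex.exp w)
    + Complex.Gamma (c - 1) / Complex.Gamma a * Complex.exp ((1 - c) * w)
      * kummerM (1 + a - c) (2 - c) (Complex.exp w)

open Classical in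
/-- The Tricomi confluent hypergeometric function `ψ(a,c,x)` at the point `x = exp w` of the
universal covering of the punctured plane. For integer `c` it is defined by continuity in `c`. -/
def tricomi (a c w : ℂ) : ℂ :=
  if ∃ n : ℤ, c = n then limUnder (𝓝[≠] c) (fun c' : ℂ => tricomiGeneric a c' w)
  else tricomiGeneric a c w

/-! ### The contour -/

/-- The logarithm of `ζ` with `0 < arg ζ < 2π` off the positive half-line
(and `arg ζ = 2π` on it). -/
def logBranch (ζ : ℂ) : ℂ := Complex.log (-ζ) + Real.pi * Complex.I

/-- The argument of `ζ` in `(0, 2π]`. -/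
def argBranch (ζ : ℂ) : ℝ := (logBranch ζ).im

/-- The power `ζ^a` with `0 < arg ζ < 2π`. -/
def powBranch (a ζ : ℂ) : ℂ := Complex.exp (a * logBranch ζ)

/-- The directions of the four rays that lie in the open quadrants. -/
structure Directions where
  t2 : ℝ
  t4 : ℝ
  t6 : ℝ
  t8 : ℝ
  h8 : 0 < t8 ∧ t8 < Real.pi / 2
  h2 : Real.pi / 2 < t2 ∧ t2 < Real.pi
  h4 : Real.pi < t4 ∧ t4 < 3 * Real.pi / 2
  h6 : 3 * Real.pi / 2 < t6 ∧ t6 < 2 * Real.pi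

/-- The names of the rays `Γ₁, …, Γ₈`. -/
inductive Ray
  | r1 | r2 | r3 | r4 | r5 | r6 | r7 | r8

/-- The names of the eight open sectors; each lies between two consecutive rays:
`I` between `Γ₁` and `Γ₂`, …, `VII` between `Γ₇` and `Γ₈`, `VIII` between `Γ₈` and `Γ₁`. -/
inductive Sector
  | I | II | III | IV | V | VI | VII | VIII

/-- The direction of each ray: `Γ₁, Γ₃, Γ₅, Γ₇` are the positive imaginary, negative real,
negative imaginary and positive real half-axes. -/
def rayAngle (D : Directions) : Ray → ℝ
  | .r1 => Real.pi / 2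
  | .r2 => D.t2
  | .r3 => Real.pi
  | .r4 => D.t4
  | .r5 => 3 * Real.pi / 2
  | .r6 => D.t6
  | .r7 => 0
  | .r8 => D.t8

/-- The ray `Γ_k` without the origin. -/
def raySet (D : Directions) (k : Ray) : Set ℂ :=
  {ζ | ∃ r : ℝ, 0 < r ∧ ζ = r * Complex.exp (rayAngle D k * Complex.I)}

/-- The union of the eight closed rays. -/
def contour (D : Directions) : Set ℂ := {0} ∪ ⋃ k : Ray, raySet D k

/-- The bounds for the argument in each sector. -/
def sectorBounds (D : Directions) : Sector → ℝ × ℝ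
  | .I => (Real.pi / 2, D.t2)
  | .II => (D.t2, Real.pi)
  | .III => (Real.pi, D.t4)
  | .IV => (D.t4, 3 * Real.pi / 2)
  | .V => (3 * Real.pi / 2, D.t6)
  | .VI => (D.t6, 2 * Real.pi)
  | .VII => (0, D.t8)
  | .VIII => (D.t8, Real.pi / 2)

/-- The open sector with a given name. -/
def sectorSet (D : Directions) (s : Sector) : Set ℂ :=
  {ζ | ζ ≠ 0 ∧ (sectorBounds D s).1 < argBranch ζ ∧ argBranch ζ < (sectorBounds D s).2}

/-- The sector on the left (`+`) side of each ray. The rays `Γ₁, Γ₂, Γ₃, Γ₇, Γ₈` are oriented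
away from the origin, and `Γ₄, Γ₅, Γ₆` towards it. -/
def plusSide : Ray → Sector
  | .r1 => .I
  | .r2 => .II
  | .r3 => .III
  | .r4 => .III
  | .r5 => .IV
  | .r6 => .V
  | .r7 => .VII
  | .r8 => .VIII

/-- The sector on the right (`-`) side of each ray. -/
def minusSide : Ray → Sector
  | .r1 => .VIII
  | .r2 => .I
  | .r3 => .II
  | .r4 => .IV
  | .r5 => .V
  | .r6 => .VI
  | .r7 => .VI
  | .r8 => .VII

/-! ### The model Riemann–Hilbert problem -/

/-- `exp(iπx)`. -/
def expPi (x : ℂ) : ℂ := Complex.exp (Complex.I * Real.pi * x)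

/-- The jump matrices. -/
def jump (α β : ℂ) : Ray → Matrix (Fin 2) (Fin 2) ℂ
  | .r1 => !![0, expPi (-β); -expPi β, 0]
  | .r5 => !![0, expPi β; -expPi (-β), 0]
  | .r3 => !![expPi α, 0; 0, expPi (-α)]
  | .r7 => !![expPi α, 0; 0, expPi (-α)]
  | .r2 => !![1, 0; expPi (β - 2 * α), 1]
  | .r4 => !![1, 0; expPi (-(β - 2 * α)), 1]
  | .r8 => !![1, 0; expPi (β + 2 * α), 1]
  | .r6 => !![1, 0; expPi (-(β + 2 * α)), 1]

/-- The sectors outside the lenses are `II, III, VI, VII`. For a function `Ψ` with the jumps above,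
multiplication by this matrix on the right continues the values of `Ψ` outside the lenses
into the neighbouring sector `I, IV, V, VIII` (through `Γ₂, Γ₄, Γ₆, Γ₈` respectively). -/
def fromOutside (α β : ℂ) : Sector → Matrix (Fin 2) (Fin 2) ℂ
  | .I => jump α β .r2
  | .II => 1
  | .III => 1
  | .IV => jump α β .r4
  | .V => (jump α β .r6)⁻¹
  | .VI => 1
  | .VII => 1
  | .VIII => (jump α β .r8)⁻¹

/-- `Ψ` is a solution of the model Riemann–Hilbert problem with parameters `α, β`:
analyticity off the contour, jumps, and behaviour at the origin. -/
structure IsModelSolution (D : Directions) (α β : ℂ)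
    (Ψ : ℂ → Matrix (Fin 2) (Fin 2) ℂ) : Prop where
  analytic : ∀ i j : Fin 2, AnalyticOnNhd ℂ (fun ζ => Ψ ζ i j) (contour D)ᶜ
  /-- The boundary values from both sides exist and are related by the jump matrix. -/
  jumps : ∀ k : Ray, ∀ ζ₀ ∈ raySet D k, ∃ Ψplus Ψminus : Matrix (Fin 2) (Fin 2) ℂ,
    Tendsto Ψ (𝓝[sectorSet D (plusSide k)] ζ₀) (𝓝 Ψplus) ∧
    Tendsto Ψ (𝓝[sectorSet D (minusSide k)] ζ₀) (𝓝 Ψminus) ∧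
    Ψplus = Ψminus * jump α β k
  /-- Behaviour at the origin for `α ≠ 0`: outside the lenses the first column is `O(ζ^α)` and the
  second one `O(ζ^α) + O(ζ^(-α))`; inside the lenses it follows by the jump conditions. -/
  zero_of_ne : α ≠ 0 → ∀ s : Sector, ∀ i : Fin 2,
    ((fun ζ => (Ψ ζ * fromOutside α β s) i 0) =O[𝓝[sectorSet D s] 0] fun ζ => powBranch α ζ) ∧
    ((fun ζ => (Ψ ζ * fromOutside α β s) i 1) =O[𝓝[sectorSet D s] 0]
      fun ζ => ‖powBranch α ζ‖ + ‖powBranch (-α) ζ‖)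
  /-- Behaviour at the origin for `α = 0`, `β ≠ 0`: the columns are `O(1)` and `O(ln|ζ|)`
  outside the lenses; inside the lenses it follows by the jump conditions. -/
  zero_of_eq : α = 0 → β ≠ 0 → ∀ s : Sector, ∀ i : Fin 2,
    ((fun ζ => (Ψ ζ * fromOutside α β s) i 0) =O[𝓝[sectorSet D s] 0] fun _ => (1 : ℝ)) ∧
    ((fun ζ => (Ψ ζ * fromOutside α β s) i 1) =O[𝓝[sectorSet D s] 0] fun ζ => Real.log ‖ζ‖)

/-! ### The explicit solution -/

/-- The explicit formula for `Ψ` in the sector `I`, continued to `0 < arg ζ < 2π`. -/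
def psiOne (α β ζ : ℂ) : Matrix (Fin 2) (Fin 2) ℂ :=
  !![powBranch α ζ * tricomi (α + β) (1 + 2 * α) (logBranch ζ)
        * expPi (2 * β + α) * Complex.exp (-ζ / 2),
      -powBranch α ζ * tricomi (1 + α - β) (1 + 2 * α) (logBranch ζ - Real.pi * Complex.I)
        * expPi (β + α) * Complex.exp (ζ / 2)
        * (Complex.Gamma (1 + α - β) / Complex.Gamma (α + β));
     -powBranch (-α) ζ * tricomi (1 - α + β) (1 - 2 * α) (logBranch ζ)
        * expPi (β - 3 * α) * Complex.exp (-ζ / 2)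
        * (Complex.Gamma (1 + α + β) / Complex.Gamma (α - β)),
      powBranch (-α) ζ * tricomi (-α - β) (1 - 2 * α) (logBranch ζ - Real.pi * Complex.I)
        * expPi (-α) * Complex.exp (ζ / 2)]

/-- The matrix obtained by applying successively the jump conditions on the way from the sector `I`
to the given sector (counterclockwise to `II, …, VI`, clockwise to `VIII, VII`). -/
def fromSectorOne (α β : ℂ) : Sector → Matrix (Fin 2) (Fin 2) ℂ
  | .I => 1
  | .II => jump α β .r2
  | .III => jump α β .r2 * jump α β .r3
  | .IV => jump α β .r2 * jump α β .r3 * (jump α β .r4)⁻¹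
  | .V => jump α β .r2 * jump α β .r3 * (jump α β .r4)⁻¹ * (jump α β .r5)⁻¹
  | .VI => jump α β .r2 * jump α β .r3 * (jump α β .r4)⁻¹ * (jump α β .r5)⁻¹ * (jump α β .r6)⁻¹
  | .VIII => (jump α β .r1)⁻¹
  | .VII => (jump α β .r1)⁻¹ * (jump α β .r8)⁻¹

/-- The name of the sector that contains `ζ` (on the rays themselves the choice is irrelevant). -/
def sectorOf (D : Directions) (ζ : ℂ) : Sector :=
  if argBranch ζ < D.t8 then .VII
  else if argBranch ζ < Real.pi / 2 then .VIII
  else if argBranch ζ < D.t2 then .I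
  else if argBranch ζ < Real.pi then .II
  else if argBranch ζ < D.t4 then .III
  else if argBranch ζ < 3 * Real.pi / 2 then .IV
  else if argBranch ζ < D.t6 then .V
  else .VI

/-- The explicit function: the formula of sector `I`, and in the other sectors what the jump
conditions make of it. -/
def modelPsi (D : Directions) (α β ζ : ℂ) : Matrix (Fin 2) (Fin 2) ℂ :=
  psiOne α β ζ * fromSectorOne α β (sectorOf D ζ)

end FisherHartwig

end

open Filter Topology Asymptotics

noncomputable section

namespace FisherHartwig

/-! ### The regularized Kummer function -/

/-! Put `w = log ζ`, `x = exp w` and `c = 1 + 2α`. The symmetry `ψ(1+a-c, 2-c, x) = x^(c-1) ψ(a, c,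
x)` gives both rows of the matrix in sector I the same shape: up to constants, `f = x^α e^(-x/2)
ψ(a, c, x)` and `g = x^α e^(x/2) ψ(c-a, c, e^(-iπ) x)`, with `a = α+β` in the first row and `a =
1+α+β` in the second. Both are entire functions of `w`, and two facts about them
(`isModelRow_tricomi`) carry the theorem.

Connection (`kummerR_eq_tricomi`): `f + e^(iπ(β-2α)) g` is a multiple of `x^α e^(-x/2)
M(a,c,x)/Γ(c)`, that is, `x^α` times an entire function of `x`. Outside the lenses the first column
is a constant multiple of it, hence `O(ζ^α)`; one turn around the origin multiplies it by
`e^(2πiα)`.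

Monodromy (`tricomi_monodromy`): one turn changes `g` into `e^(-2πiα) g` plus a multiple of the same
combination.

Away from `Γ₇` the logarithm is continuous and the jumps hold by construction. The sectors VI and
VII are reached from I in opposite directions, so the jump on `Γ₇` is the one genuine condition: it
compares `w = log r` with `log r + 2πi` and follows from these two facts. At the origin,
`exists_tricomi_eq` gives `x^α A(x) + x^(-α) (B(x) + w E(x))` with `A`, `B`, `E` entire and `E(0) =
0` unless `α = 0`, which yields the bounds for the second column.

Integer `c` is handled by writing `ψ = π / sin(πc) · N` with `N` entire in all variables and zero at
integer `c`. Identities are proved for non-integer `c` and passed to the limit along complex lines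
in the parameter space. -/

/-- The rising factorial `(a)ₙ`. -/
def rising (n : ℕ) (a : ℂ) : ℂ := (ascPochhammer ℂ n).eval a

/-- The reciprocal Gamma function. -/
def rGamma (z : ℂ) : ℂ := (Complex.Gamma z)⁻¹

lemma differentiable_rGamma : Differentiable ℂ rGamma := Complex.differentiable_one_div_Gamma

lemma differentiable_rising (n : ℕ) : Differentiable ℂ (rising n) :=
  (ascPochhammer ℂ n).differentiable

lemma rising_zero (a : ℂ) : rising 0 a = 1 := by simp [rising]

lemma rising_succ (n : ℕ) (a : ℂ) : rising (n + 1) a = rising n a * (a + n) :=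
  ascPochhammer_succ_eval n a

lemma rGamma_eq_mul (z : ℂ) : rGamma z = z * rGamma (z + 1) :=
  Complex.one_div_Gamma_eq_self_mul_one_div_Gamma_add_one z

lemma rGamma_eq_rising_mul (n : ℕ) (z : ℂ) : rGamma z = rising n z * rGamma (z + n) := by
  induction n with
  | zero => simp [rising_zero]
  | succ n ih =>
    rw [ih, rising_succ, rGamma_eq_mul (z + n)]
    push_cast
    ring_nf

lemma rising_add (m n : ℕ) (a : ℂ) : rising (m + n) a = rising m a * rising n (a + m) := by
  induction n with
  | zero => simp [rising_zero]
  | succ n ih =>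
    rw [← add_assoc, rising_succ, ih, rising_succ]
    push_cast
    ring

lemma rGamma_neg_nat (n : ℕ) : rGamma (-n) = 0 := by simp [rGamma, Complex.Gamma_neg_nat_eq_zero]

lemma rGamma_nat_add_one (n : ℕ) : rGamma (n + 1) = (n.factorial : ℂ)⁻¹ := by
  simp [rGamma, Complex.Gamma_nat_eq_factorial]

lemma rGamma_mul_rGamma_one_sub (z : ℂ) :
    rGamma z * rGamma (1 - z) = Complex.sin (Real.pi * z) / Real.pi := by
  rw [rGamma, rGamma, ← mul_inv, Complex.Gamma_mul_Gamma_one_sub, inv_div]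

/-- Coefficients of the regularized Kummer function. -/
def kummerCoeff (a c : ℂ) (n : ℕ) : ℂ := rising n a * rGamma (c + n) / n.factorial

/-- The regularized Kummer function `M(a,c,x) / Γ(c)`. -/
def kummerR (a c x : ℂ) : ℂ := ∑' n, kummerCoeff a c n * x ^ n

lemma regularizedHGFun_eq_kummerR (a c x : ℂ) :
    Complex.regularizedHGFun {a} {c} x = kummerR a c x := by
  have h := FormalMultilinearSeries.ofScalars_sum_eq (E := ℂ)
    (Complex.regularizedHGFunCoeff {a} {c}) x
  refine Eq.trans h (tsum_congr fun n => ?_)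
  simp only [Complex.regularizedHGFunCoeff, kummerCoeff, rising, rGamma, smul_eq_mul,
    Multiset.map_singleton, Multiset.prod_singleton]
  congr 1
  rw [div_eq_mul_inv, mul_inv, div_eq_mul_inv]
  ring

/-- Vandermonde's identity in terms of the coefficients of the Kummer function. -/
lemma sum_antidiagonal_kummerCoeff (a c : ℂ) (n : ℕ) :
    ∑ ij ∈ Finset.HasAntidiagonal.antidiagonal n,
      (-1) ^ ij.1 * kummerCoeff (c - a) c ij.1 * ((ij.2.factorial : ℂ)⁻¹) = kummerCoeff a c n := by
  have hd : ∀ (k : ℕ) (r : ℂ), (descPochhammer ℤ k).smeval r = rising k (r - k + 1) := by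
    intro k r
    rw [Polynomial.descPochhammer_smeval_eq_ascPochhammer, Polynomial.ascPochhammer_smeval_eq_eval]
    rfl
  have hneg : ∀ (k : ℕ) (r : ℂ), rising k (r - k + 1) = (-1) ^ k * rising k (-r) := by
    intro k r
    rw [rising, rising, ascPochhammer_eval_neg_eq_descPochhammer,
      descPochhammer_eval_eq_ascPochhammer, ← mul_assoc, ← mul_pow]
    simp
  -- With these `r` and `s` the falling factorial of `r + s` is `(a)ₙ`. That of `r` becomes `(-1)^j
  -- (c-a)ⱼ`, and that of `s` becomes `(c+j)ᵢ`, the quotient of `1/Γ(c+j)` by `1/Γ(c+n)`.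
  have h := Ring.descPochhammer_smeval_add (R := ℂ) (r := a - c) (s := c + n - 1) n
    (Commute.all _ _)
  rw [hd, show a - c + (c + n - 1) - n + 1 = a by ring] at h
  rw [kummerCoeff, h, Finset.sum_mul, Finset.sum_div]
  refine Finset.sum_congr rfl fun ij hij => ?_
  obtain ⟨j, i⟩ := ij
  have hji : j + i = n := by simpa using hij
  subst hji
  simp only
  rw [hd, hd, hneg j, show -(a - c) = c - a by ring, kummerCoeff,
    rGamma_eq_rising_mul i (c + j), Nat.cast_add, show c + (j + i) - 1 - i + 1 = c + (j : ℂ) by ring,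
    add_assoc, ← Nat.add_choose_mul_factorial_mul_factorial j i, ← Nat.choose_symm_add]
  have h1 : ((j + i).choose j : ℂ) ≠ 0 := by
    exact_mod_cast (Nat.choose_pos (Nat.le_add_right j i)).ne'
  have h2 : (j.factorial : ℂ) ≠ 0 := by exact_mod_cast j.factorial_ne_zero
  have h3 : (i.factorial : ℂ) ≠ 0 := by exact_mod_cast i.factorial_ne_zero
  push_cast
  field_simp

/-! ### Bounds for the coefficients, uniform in the parameters -/

lemma norm_rising_div_factorial_le {A : ℝ} (hA : 0 ≤ A) {a : ℂ} (ha : ‖a‖ ≤ A) (n : ℕ) :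
    ‖rising n a‖ / n.factorial ≤ (A + 1) ^ n := by
  induction n with
  | zero => simp [rising_zero]
  | succ n ih =>
    rw [rising_succ, Nat.factorial_succ, norm_mul, pow_succ, Nat.cast_mul,
      mul_comm ((n + 1 : ℕ) : ℝ), mul_div_mul_comm]
    refine mul_le_mul ih ?_ (by positivity) (by positivity)
    -- The ratio of consecutive terms is at most `(A+n)/(n+1) ≤ A+1`.
    rw [div_le_iff₀ (by positivity)]
    have h1 : ‖a + n‖ ≤ A + n := (norm_add_le _ _).trans (by simpa using ha)
    push_cast
    nlinarith [mul_nonneg hA (Nat.cast_nonneg (α := ℝ) n)]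

/-- Compactness bounds the values with `n ≤ N`. Beyond that, `1/Γ(z) = z/Γ(z+1)` gains a factor
`1/(m+1)` at each step, because `N ≥ ρ+1` forces `Re(c+N+m) ≥ m+1`. For `n ≤ N` the truncated
subtraction makes the factorial `1`. -/
lemma exists_norm_rGamma_add_nat_le (ρ : ℝ) :
    ∃ (C : ℝ) (N : ℕ), 0 ≤ C ∧ ∀ c : ℂ, ‖c‖ ≤ ρ → ∀ n : ℕ,
      ‖rGamma (c + n)‖ ≤ C / (n - N).factorial := by
  obtain ⟨N, hN⟩ := exists_nat_ge (ρ + 1)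
  obtain ⟨C, hC⟩ := (isCompact_closedBall (0 : ℂ) (ρ + N)).exists_bound_of_continuousOn
    differentiable_rGamma.continuous.continuousOn
  have key : ∀ c : ℂ, ‖c‖ ≤ ρ → ∀ n ≤ N, ‖rGamma (c + n)‖ ≤ C := by
    intro c hc n hn
    refine hC _ ?_
    rw [mem_closedBall_zero_iff]
    have h : (n : ℝ) ≤ N := by exact_mod_cast hn
    exact (norm_add_le _ _).trans (by simpa using add_le_add hc h)
  have step : ∀ c : ℂ, ‖c‖ ≤ ρ → ∀ m : ℕ, ‖rGamma (c + (N + m : ℕ))‖ ≤ C / m.factorial := by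
    intro c hc m
    induction m with
    | zero => simpa using key c hc N le_rfl
    | succ m ih =>
      rw [rGamma_eq_mul, norm_mul] at ih
      have hre : (m : ℝ) + 1 ≤ ‖c + (N + m : ℕ)‖ := by
        refine le_trans ?_ (Complex.re_le_norm _)
        have := (abs_le.mp ((Complex.abs_re_le_norm c).trans hc)).1
        simp
        linarith
      have hmul : ((m : ℝ) + 1) * ‖rGamma (c + (N + (m + 1) : ℕ))‖ ≤ C / m.factorial := by
        refine le_trans (mul_le_mul_of_nonneg_right hre (norm_nonneg _)) ?_
        rwa [add_assoc, ← Nat.cast_add_one] at ih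
      rw [Nat.factorial_succ, Nat.cast_mul, ← div_div, div_right_comm, le_div_iff₀ (by positivity)]
      push_cast at hmul ⊢
      linarith
  -- The constant from compactness comes without a sign; if it is negative, no `c` satisfies `‖c‖ ≤
  -- ρ`.
  rcases lt_or_ge C 0 with hneg | hC0
  · refine ⟨0, N, le_rfl, fun c hc n => ?_⟩
    exact absurd ((norm_nonneg _).trans (key c hc 0 (Nat.zero_le N))) (not_le.mpr hneg)
  · refine ⟨C, N, hC0, fun c hc n => ?_⟩
    rcases le_total n N with h | h
    · simpa [Nat.sub_eq_zero_of_le h] using key c hc n h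
    · obtain ⟨m, rfl⟩ := Nat.exists_eq_add_of_le h
      simpa using step c hc m

/-- Uniform summable bounds for the Kummer series for bounded parameters. -/
lemma exists_summable_bound (ρ : ℝ) (hρ : 0 ≤ ρ) :
    ∃ M : ℕ → ℝ, (∀ a c : ℂ, ‖a‖ ≤ ρ → ‖c‖ ≤ ρ → ∀ n, ‖kummerCoeff a c n‖ ≤ M n) ∧
      ∀ r : ℝ, Summable fun n => M n * r ^ n := by
  obtain ⟨C, N, hC, hb⟩ := exists_norm_rGamma_add_nat_le ρ
  refine ⟨fun n => (ρ + 1) ^ n * (C / (n - N).factorial), ?_, ?_⟩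
  · intro a c ha hc n
    rw [kummerCoeff, norm_div, norm_mul, mul_div_right_comm]
    simp only [Complex.norm_natCast]
    exact mul_le_mul (norm_rising_div_factorial_le hρ ha n) (hb c hc n) (norm_nonneg _)
      (by positivity)
  · intro r
    rw [← summable_nat_add_iff N]
    have h := (Real.summable_pow_div_factorial ((ρ + 1) * r)).mul_left (C * ((ρ + 1) * r) ^ N)
    refine h.congr fun n => ?_
    simp only [Nat.add_sub_cancel, pow_add, mul_pow]
    ring

lemma summable_norm_kummer (a c x : ℂ) : Summable fun n => ‖kummerCoeff a c n * x ^ n‖ := by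
  obtain ⟨M, hM, hs⟩ := exists_summable_bound (max ‖a‖ ‖c‖) (le_max_of_le_left (norm_nonneg a))
  refine Summable.of_nonneg_of_le (fun _ => norm_nonneg _) (fun n => ?_) (hs ‖x‖)
  rw [norm_mul, norm_pow]
  exact mul_le_mul_of_nonneg_right (hM a c (le_max_left _ _) (le_max_right _ _) n) (by positivity)

/-- A power series dominated by an everywhere convergent one is entire. -/
lemma differentiable_tsum_of_bound {u : ℕ → ℂ} {M : ℕ → ℝ} (hu : ∀ n, ‖u n‖ ≤ M n)
    (hM : ∀ r : ℝ, Summable fun n => M n * r ^ n) :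
    Differentiable ℂ fun x : ℂ => ∑' n, u n * x ^ n := by
  intro x
  have h := Complex.differentiableOn_tsum_of_summable_norm (F := fun n (x : ℂ) => u n * x ^ n)
    (U := Metric.ball 0 (‖x‖ + 1)) (hM (‖x‖ + 1))
    (fun n => ((differentiable_id.pow n).const_mul (u n)).differentiableOn) Metric.isOpen_ball
    (fun n w hw => by
      rw [norm_mul, norm_pow]
      refine mul_le_mul (hu n) (pow_le_pow_left₀ (norm_nonneg _) ?_ n) (by positivity)
        ((norm_nonneg _).trans (hu n))
      exact (mem_ball_zero_iff.mp hw).le)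
  exact h.differentiableAt (Metric.isOpen_ball.mem_nhds (by simp))

lemma differentiable_kummerR (a c : ℂ) : Differentiable ℂ (kummerR a c) := by
  obtain ⟨M, hM, hs⟩ := exists_summable_bound (max ‖a‖ ‖c‖) (le_max_of_le_left (norm_nonneg a))
  exact differentiable_tsum_of_bound (hM a c (le_max_left _ _) (le_max_right _ _)) hs

/-- Kummer's transformation. -/
lemma kummerR_eq_exp_mul (a c x : ℂ) :
    kummerR a c x = Complex.exp x * kummerR (c - a) c (-x) := by
  have he : Summable fun n : ℕ => ‖x ^ n / (n.factorial : ℂ)‖ :=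
    NormedSpace.norm_expSeries_div_summable x
  rw [Complex.exp_eq_exp_ℂ, NormedSpace.exp_eq_tsum_div, mul_comm, kummerR, kummerR,
    tsum_mul_tsum_eq_tsum_sum_antidiagonal_of_summable_norm (summable_norm_kummer (c - a) c (-x)) he]
  refine tsum_congr fun n => ?_
  rw [← sum_antidiagonal_kummerCoeff, Finset.sum_mul]
  refine Finset.sum_congr rfl fun ij hij => ?_
  rw [← Finset.HasAntidiagonal.mem_antidiagonal.mp hij, pow_add, neg_pow x]
  ring

/-- The Kummer function at a nonpositive integer second parameter. -/
lemma kummerR_one_sub_nat (a x : ℂ) (m : ℕ) :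
    kummerR a (1 - m) x * rGamma (a + m) = x ^ m * kummerR (a + m) (1 + m) x * rGamma a := by
  have hs := (summable_norm_kummer a (1 - m) x).of_norm
  -- For `i < m` the number `1 - m + i` is a zero of `1/Γ`, so the series starts at `x ^ m`.
  have h0 : ∑ i ∈ Finset.range m, kummerCoeff a (1 - m) i * x ^ i = 0 := by
    refine Finset.sum_eq_zero fun i hi => ?_
    obtain ⟨k, hk⟩ := Nat.exists_eq_add_of_lt (Finset.mem_range.mp hi)
    rw [kummerCoeff, show (1 - m + i : ℂ) = -(k : ℂ) by rw [hk]; push_cast; ring, rGamma_neg_nat]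
    simp
  rw [kummerR, ← hs.sum_add_tsum_nat_add m, h0, zero_add, kummerR, ← tsum_mul_right,
    ← tsum_mul_left, ← tsum_mul_right]
  refine tsum_congr fun k => ?_
  rw [kummerCoeff, kummerCoeff, rGamma_eq_rising_mul m a, add_comm k m, rising_add, Nat.cast_add,
    show (1 - m + (m + k) : ℂ) = k + 1 by ring, rGamma_nat_add_one,
    show (1 + m + k : ℂ) = (m + k : ℕ) + 1 by push_cast; ring, rGamma_nat_add_one, pow_add]
  field_simp

/-- Derivative of the coefficients in the first parameter. -/
def kummerCoeffDerivA (a c : ℂ) (n : ℕ) : ℂ := deriv (rising n) a * rGamma (c + n) / n.factorial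

/-- Derivative of the coefficients in the second parameter. -/
def kummerCoeffDerivC (a c : ℂ) (n : ℕ) : ℂ := rising n a * deriv rGamma (c + n) / n.factorial

/-- Derivative of `kummerR` in the first parameter. -/
def kummerRDerivA (a c x : ℂ) : ℂ := ∑' n, kummerCoeffDerivA a c n * x ^ n

/-- Derivative of `kummerR` in the second parameter. -/
def kummerRDerivC (a c x : ℂ) : ℂ := ∑' n, kummerCoeffDerivC a c n * x ^ n

/-- Restricting to complex lines `(a + s t, c + r t)` reduces the dependence on two parameters to
one complex variable. -/
lemma hasDerivAt_kummerCoeff (a c s r t : ℂ) (n : ℕ) :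
    HasDerivAt (fun t : ℂ => kummerCoeff (a + s * t) (c + r * t) n)
      (s * kummerCoeffDerivA (a + s * t) (c + r * t) n
        + r * kummerCoeffDerivC (a + s * t) (c + r * t) n) t := by
  have ha : HasDerivAt (fun t : ℂ => a + s * t) s t := by
    simpa using ((hasDerivAt_id t).const_mul s).const_add a
  have hc : HasDerivAt (fun t : ℂ => c + r * t + n) r t := by
    simpa using (((hasDerivAt_id t).const_mul r).const_add c).add_const (n : ℂ)
  have h1 := (differentiable_rising n (a + s * t)).hasDerivAt.comp t ha
  have h2 := (differentiable_rGamma (c + r * t + n)).hasDerivAt.comp t hc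
  refine ((h1.mul h2).div_const (n.factorial : ℂ)).congr_deriv ?_
  simp only [kummerCoeffDerivA, kummerCoeffDerivC, Function.comp]
  ring

lemma exists_bound_line (a c s r : ℂ) :
    ∃ M : ℕ → ℝ, (∀ t : ℂ, ‖t‖ ≤ 1 → ∀ n, ‖kummerCoeff (a + s * t) (c + r * t) n‖ ≤ M n) ∧
      ∀ r : ℝ, Summable fun n => M n * r ^ n := by
  obtain ⟨M, hM, hs⟩ := exists_summable_bound (max (‖a‖ + ‖s‖) (‖c‖ + ‖r‖))
    (le_max_of_le_left (by positivity))
  refine ⟨M, fun t ht n => hM _ _ (le_max_of_le_left ?_) (le_max_of_le_right ?_) n, hs⟩ <;>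
  · refine (norm_add_le _ _).trans (add_le_add_right ?_ _)
    rw [norm_mul]
    exact mul_le_of_le_one_right (norm_nonneg _) ht

/-- Cauchy's estimate on the unit circle in `t`: the derivative inherits the bound of the
coefficients, so the differentiated series also converges everywhere. -/
lemma norm_deriv_kummerCoeff_le {a c s r : ℂ} {M : ℕ → ℝ}
    (hM : ∀ t : ℂ, ‖t‖ ≤ 1 → ∀ n, ‖kummerCoeff (a + s * t) (c + r * t) n‖ ≤ M n) (n : ℕ) :
    ‖s * kummerCoeffDerivA a c n + r * kummerCoeffDerivC a c n‖ ≤ M n := by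
  have hd : Differentiable ℂ fun t : ℂ => kummerCoeff (a + s * t) (c + r * t) n :=
    fun t => (hasDerivAt_kummerCoeff a c s r t n).differentiableAt
  have h := Complex.norm_deriv_le_of_forall_mem_sphere_norm_le (c := 0) one_pos
    hd.diffContOnCl (fun t ht => hM t (mem_sphere_zero_iff_norm.mp ht).le n)
  rw [(hasDerivAt_kummerCoeff a c s r 0 n).deriv] at h
  simpa using h

lemma exists_bound_derivs (a c : ℂ) :
    ∃ M : ℕ → ℝ, (∀ n, ‖kummerCoeffDerivA a c n‖ ≤ M n ∧ ‖kummerCoeffDerivC a c n‖ ≤ M n) ∧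
      ∀ r : ℝ, Summable fun n => M n * r ^ n := by
  obtain ⟨M₁, hM₁, hs₁⟩ := exists_bound_line a c 1 0
  obtain ⟨M₂, hM₂, hs₂⟩ := exists_bound_line a c 0 1
  have h₁ := norm_deriv_kummerCoeff_le hM₁
  have h₂ := norm_deriv_kummerCoeff_le hM₂
  simp only [one_mul, zero_mul, add_zero, zero_add] at h₁ h₂
  refine ⟨fun n => M₁ n + M₂ n, fun n => ⟨?_, ?_⟩, fun r => ?_⟩
  · exact le_add_of_le_of_nonneg (h₁ n) ((norm_nonneg _).trans (h₂ n))
  · exact le_add_of_nonneg_of_le ((norm_nonneg _).trans (h₁ n)) (h₂ n)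
  · simpa only [add_mul] using (hs₁ r).add (hs₂ r)

lemma differentiable_kummerRDerivA (a c : ℂ) : Differentiable ℂ (kummerRDerivA a c) := by
  obtain ⟨M, hM, hs⟩ := exists_bound_derivs a c
  exact differentiable_tsum_of_bound (fun n => (hM n).1) hs

lemma differentiable_kummerRDerivC (a c : ℂ) : Differentiable ℂ (kummerRDerivC a c) := by
  obtain ⟨M, hM, hs⟩ := exists_bound_derivs a c
  exact differentiable_tsum_of_bound (fun n => (hM n).2) hs

lemma summable_of_bound {u : ℕ → ℂ} {M : ℕ → ℝ} (hu : ∀ n, ‖u n‖ ≤ M n)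
    (hM : ∀ r : ℝ, Summable fun n => M n * r ^ n) (x : ℂ) : Summable fun n => u n * x ^ n := by
  refine Summable.of_norm_bounded (hM ‖x‖) fun n => ?_
  rw [norm_mul, norm_pow]
  exact mul_le_mul_of_nonneg_right (hu n) (by positivity)

/-- Derivative of the regularized Kummer function along lines in the parameter space. -/
lemma hasDerivAt_kummerR (a c s r x : ℂ) :
    HasDerivAt (fun t : ℂ => kummerR (a + s * t) (c + r * t) x)
      (s * kummerRDerivA a c x + r * kummerRDerivC a c x) 0 := by
  obtain ⟨M, hM, hs⟩ := exists_bound_line a c s r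
  have hd : ∀ n, Differentiable ℂ fun t : ℂ => kummerCoeff (a + s * t) (c + r * t) n * x ^ n :=
    fun n t => ((hasDerivAt_kummerCoeff a c s r t n).differentiableAt).mul_const _
  have hb : ∀ (n : ℕ) (t : ℂ), t ∈ Metric.ball (0 : ℂ) 1 →
      ‖kummerCoeff (a + s * t) (c + r * t) n * x ^ n‖ ≤ M n * ‖x‖ ^ n := by
    intro n t ht
    rw [norm_mul, norm_pow]
    exact mul_le_mul_of_nonneg_right (hM t (mem_ball_zero_iff.mp ht).le n) (by positivity)
  have h0 : (0 : ℂ) ∈ Metric.ball (0 : ℂ) 1 := by simp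
  have h1 := Complex.hasSum_deriv_of_summable_norm (hs ‖x‖)
    (fun n => (hd n).differentiableOn) Metric.isOpen_ball hb h0
  have h2 := (Complex.differentiableOn_tsum_of_summable_norm (hs ‖x‖)
    (fun n => (hd n).differentiableOn) Metric.isOpen_ball hb).differentiableAt
    (Metric.isOpen_ball.mem_nhds h0)
  refine h2.hasDerivAt.congr_deriv ?_
  rw [← h1.tsum_eq]
  obtain ⟨M', hM', hs'⟩ := exists_bound_derivs a c
  rw [kummerRDerivA, kummerRDerivC, ← tsum_mul_left, ← tsum_mul_left, ← Summable.tsum_add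
    ((summable_of_bound (fun n => (hM' n).1) hs' x).mul_left s)
    ((summable_of_bound (fun n => (hM' n).2) hs' x).mul_left r)]
  refine tsum_congr fun n => ?_
  rw [((hasDerivAt_kummerCoeff a c s r 0 n).mul_const (x ^ n)).deriv]
  simp only [mul_zero, add_zero]
  ring

/-! ### Tricomi's function -/

lemma exp_pi_mul_I_eq (z : ℂ) :
    Complex.exp (Complex.I * Real.pi * z) =
      Complex.cos (Real.pi * z) + Complex.I * Complex.sin (Real.pi * z) := by
  rw [mul_assoc, mul_comm, Complex.exp_mul_I]
  ring

lemma sin_pi_mul_eq_zero_iff (c : ℂ) : Complex.sin (Real.pi * c) = 0 ↔ ∃ n : ℤ, c = n := by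
  have hpi : (Real.pi : ℂ) ≠ 0 := by exact_mod_cast Real.pi_ne_zero
  rw [Complex.sin_eq_zero_iff]
  refine exists_congr fun n => ⟨fun h => ?_, fun h => by rw [h, mul_comm]⟩
  rw [mul_comm] at h
  exact mul_right_cancel₀ hpi h

/-- The numerator of Tricomi's function; it is entire in all variables. -/
def tricomiNum (a c w : ℂ) : ℂ :=
  kummerR a c (Complex.exp w) * rGamma (1 + a - c)
    - Complex.exp ((1 - c) * w) * kummerR (1 + a - c) (2 - c) (Complex.exp w) * rGamma a

/-- The reflection formula at `c` and at `c - 1` turns all Gamma factors in `c` into `±π / sin(πc)`.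
At integer `c` both sides have the default value `0`. -/
lemma tricomiGeneric_eq (a c w : ℂ) :
    tricomiGeneric a c w = Real.pi / Complex.sin (Real.pi * c) * tricomiNum a c w := by
  have h1 := Complex.Gamma_mul_Gamma_one_sub c
  have h2 := Complex.Gamma_mul_Gamma_one_sub (c - 1)
  rw [show 1 - (c - 1) = 2 - c by ring, mul_sub, mul_one, Complex.sin_sub_pi, div_neg] at h2
  simp only [tricomiGeneric, kummerM, regularizedHGFun_eq_kummerR, tricomiNum, rGamma]
  linear_combination (kummerR a c (Complex.exp w) * (Complex.Gamma (1 + a - c))⁻¹) * h1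
    + (Complex.exp ((1 - c) * w) * kummerR (1 + a - c) (2 - c) (Complex.exp w)
      * (Complex.Gamma a)⁻¹) * h2

/-- The substitution `(a, c) ↦ (1+a-c, 2-c)` is an involution that exchanges the two terms, up to
the power of `x`. -/
lemma tricomiNum_symm (a c w : ℂ) :
    tricomiNum (1 + a - c) (2 - c) w = -Complex.exp ((c - 1) * w) * tricomiNum a c w := by
  have he : Complex.exp ((c - 1) * w) * Complex.exp ((1 - c) * w) = 1 := by
    rw [← Complex.exp_add]
    simp [← add_mul]
  simp only [tricomiNum]
  rw [show 1 + (1 + a - c) - (2 - c) = a by ring, show 1 - (2 - c) = c - 1 by ring,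
    show 2 - (2 - c) = c by ring]
  linear_combination
    (-kummerR (1 + a - c) (2 - c) (Complex.exp w) * rGamma a) * he

lemma tricomiNum_one_sub_nat (a w : ℂ) (m : ℕ) : tricomiNum a (1 - m) w = 0 := by
  have h := kummerR_one_sub_nat a (Complex.exp w) m
  simp only [tricomiNum]
  rw [show 1 + a - (1 - m) = a + (m : ℂ) by ring, show 2 - (1 - m) = 1 + (m : ℂ) by ring,
    show 1 - (1 - m) = (m : ℂ) by ring, Complex.exp_nat_mul, h, sub_self]

/-- For `c ≤ 1` the two terms coincide by `kummerR_one_sub_nat`; the symmetry covers `c ≥ 1`. These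
zeros cancel those of `sin(πc)`. -/
lemma tricomiNum_int (a w : ℂ) (n : ℤ) : tricomiNum a n w = 0 := by
  obtain ⟨m, h | h⟩ := Int.eq_nat_or_neg (1 - n)
  · have hn : (n : ℂ) = 1 - (m : ℂ) := by
      have : n = 1 - (m : ℤ) := by omega
      rw [this]
      push_cast
      ring
    rw [hn, tricomiNum_one_sub_nat]
  · have hn : (2 - n : ℂ) = 1 - (m : ℂ) := by
      have : n = 1 + (m : ℤ) := by omega
      rw [this]
      push_cast
      ring
    have h2 := tricomiNum_symm a n w
    rw [hn, tricomiNum_one_sub_nat] at h2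
    simpa using h2

/-- Derivative of `tricomiNum` in the first parameter. -/
def tricomiNumDerivA (a c w : ℂ) : ℂ :=
  kummerRDerivA a c (Complex.exp w) * rGamma (1 + a - c)
    + kummerR a c (Complex.exp w) * deriv rGamma (1 + a - c)
    - Complex.exp ((1 - c) * w) * (kummerRDerivA (1 + a - c) (2 - c) (Complex.exp w) * rGamma a
      + kummerR (1 + a - c) (2 - c) (Complex.exp w) * deriv rGamma a)

/-- Derivative of `tricomiNum` in the second parameter. -/
def tricomiNumDerivC (a c w : ℂ) : ℂ :=
  kummerRDerivC a c (Complex.exp w) * rGamma (1 + a - c)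
    - kummerR a c (Complex.exp w) * deriv rGamma (1 + a - c)
    + Complex.exp ((1 - c) * w) * ((kummerRDerivA (1 + a - c) (2 - c) (Complex.exp w)
      + kummerRDerivC (1 + a - c) (2 - c) (Complex.exp w)) * rGamma a
      + w * (kummerR (1 + a - c) (2 - c) (Complex.exp w) * rGamma a))

lemma hasDerivAt_tricomiNum (a c s r w : ℂ) :
    HasDerivAt (fun t : ℂ => tricomiNum (a + s * t) (c + r * t) w)
      (s * tricomiNumDerivA a c w + r * tricomiNumDerivC a c w) 0 := by
  have hlin : ∀ u v : ℂ, HasDerivAt (fun t : ℂ => u + v * t) v 0 := fun u v => by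
    simpa using ((hasDerivAt_id (0 : ℂ)).const_mul v).const_add u
  have hG : ∀ u v : ℂ, HasDerivAt (fun t : ℂ => rGamma (u + v * t)) (deriv rGamma u * v) 0 := by
    intro u v
    refine HasDerivAt.comp (h₂ := rGamma) 0 ?_ (hlin u v)
    simpa using (differentiable_rGamma u).hasDerivAt
  have h1 := (hasDerivAt_kummerR a c s r (Complex.exp w)).mul (hG (1 + a - c) (s - r))
  have h2 : HasDerivAt (fun t : ℂ => Complex.exp ((1 - c) * w + (-r * w) * t))
      (Complex.exp ((1 - c) * w) * (-r * w)) 0 := by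
    simpa using (hlin ((1 - c) * w) (-r * w)).cexp
  have h3 := (h2.mul (hasDerivAt_kummerR (1 + a - c) (2 - c) (s - r) (-r) (Complex.exp w))).mul
    (hG a s)
  refine ((h1.sub h3).congr_deriv ?_).congr_of_eventuallyEq (Eventually.of_forall fun t => ?_)
  · simp only [tricomiNumDerivA, tricomiNumDerivC, Pi.mul_apply, mul_zero, add_zero]
    ring
  · simp only [tricomiNum, Pi.sub_apply, Pi.mul_apply]
    rw [show 1 + (a + s * t) - (c + r * t) = 1 + a - c + (s - r) * t by ring,
      show 2 - (c + r * t) = 2 - c + -r * t by ring,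
      show (1 - (c + r * t)) * w = (1 - c) * w + -r * w * t by ring]

/-- At integer `c` the numerator vanishes identically in `a`. Hence the limit defining `ψ` does not
depend on how `a` moves with `c`. -/
lemma tricomiNumDerivA_int (a w : ℂ) (n : ℤ) : tricomiNumDerivA a n w = 0 := by
  have h := hasDerivAt_tricomiNum a n 1 0 w
  simp only [zero_mul, add_zero, tricomiNum_int, one_mul] at h
  exact h.unique (hasDerivAt_const _ _)

/-! ### Limits at integer values of the second parameter -/

lemma hasDerivAt_sin_line (c r : ℂ) :
    HasDerivAt (fun t : ℂ => Complex.sin (Real.pi * (c + r * t)))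
      (Complex.cos (Real.pi * c) * (Real.pi * r)) 0 := by
  have h : HasDerivAt (fun t : ℂ => Real.pi * (c + r * t)) (Real.pi * r) 0 := by
    simpa using (((hasDerivAt_id (0 : ℂ)).const_mul r).const_add c).const_mul (Real.pi : ℂ)
  simpa using h.csin

lemma cos_pi_mul_ne_zero {c : ℂ} (h : Complex.sin (Real.pi * c) = 0) :
    Complex.cos (Real.pi * c) ≠ 0 := by
  intro h'
  have := Complex.sin_sq_add_cos_sq (Real.pi * c)
  simp [h, h'] at this

lemma eventually_sin_line_ne_zero (c : ℂ) {r : ℂ} (hr : r ≠ 0) :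
    ∀ᶠ t : ℂ in 𝓝[≠] 0, Complex.sin (Real.pi * (c + r * t)) ≠ 0 := by
  have hd := hasDerivAt_sin_line c r
  by_cases h : Complex.sin (Real.pi * c) = 0
  · refine hd.eventually_ne (mul_ne_zero (cos_pi_mul_ne_zero h) (mul_ne_zero ?_ hr))
    exact_mod_cast Real.pi_ne_zero
  · exact (hd.continuousAt.eventually_ne (by simpa using h)).filter_mono nhdsWithin_le_nhds

/-- L'Hôpital's rule: numerator and sine both vanish at `t = 0`, and the quotient of their slopes
converges. The direction `(s, r)` drops out, so `a` may vary together with `c`. -/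
lemma tendsto_tricomiGeneric_int (a w s : ℂ) (n : ℤ) {r : ℂ} (hr : r ≠ 0) :
    Tendsto (fun t : ℂ => tricomiGeneric (a + s * t) (n + r * t) w) (𝓝[≠] 0)
      (𝓝 (tricomiNumDerivC a n w / Complex.cos (Real.pi * n))) := by
  have hpi : (Real.pi : ℂ) ≠ 0 := by exact_mod_cast Real.pi_ne_zero
  have hs : Complex.sin (Real.pi * n) = 0 := (sin_pi_mul_eq_zero_iff _).mpr ⟨n, rfl⟩
  have hc := cos_pi_mul_ne_zero hs
  have h1 := (hasDerivAt_tricomiNum a n s r w).tendsto_slope_zero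
  have h2 := (hasDerivAt_sin_line n r).tendsto_slope_zero
  have h3 := (h1.const_mul (Real.pi : ℂ)).div h2 (mul_ne_zero hc (mul_ne_zero hpi hr))
  have hv : Real.pi * (s * tricomiNumDerivA a n w + r * tricomiNumDerivC a n w)
      / (Complex.cos (Real.pi * n) * (Real.pi * r))
      = tricomiNumDerivC a n w / Complex.cos (Real.pi * n) := by
    rw [tricomiNumDerivA_int]
    field_simp
    ring
  rw [hv] at h3
  refine h3.congr' ?_
  filter_upwards [self_mem_nhdsWithin, eventually_sin_line_ne_zero n hr] with t ht hst
  have ht0 : t ≠ 0 := ht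
  simp only [Pi.div_apply, zero_add, mul_zero, add_zero, tricomiNum_int, hs, sub_zero, smul_eq_mul]
  rw [tricomiGeneric_eq]
  field_simp

lemma tricomi_int (a w : ℂ) (n : ℤ) :
    tricomi a n w = tricomiNumDerivC a n w / Complex.cos (Real.pi * n) := by
  rw [tricomi, if_pos ⟨n, rfl⟩]
  refine Tendsto.limUnder_eq ?_
  have h := tendsto_tricomiGeneric_int a w 0 n one_ne_zero
  have hmap : Tendsto (fun c' : ℂ => c' - n) (𝓝[≠] (n : ℂ)) (𝓝[≠] 0) := by
    refine tendsto_nhdsWithin_iff.mpr ⟨?_, ?_⟩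
    · refine Tendsto.mono_left ?_ nhdsWithin_le_nhds
      simpa using (continuous_sub_right (n : ℂ)).tendsto (n : ℂ)
    · filter_upwards [self_mem_nhdsWithin] with c' hc'
      exact sub_ne_zero.mpr hc'
  refine (h.comp hmap).congr fun c' => ?_
  simp

lemma tricomi_of_sin_ne_zero (a w : ℂ) {c : ℂ} (hc : Complex.sin (Real.pi * c) ≠ 0) :
    tricomi a c w = Real.pi / Complex.sin (Real.pi * c) * tricomiNum a c w := by
  rw [tricomi, if_neg (fun h => hc ((sin_pi_mul_eq_zero_iff c).mpr h)), tricomiGeneric_eq]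

/-- Tricomi's function is the limit of its generic values along lines in the parameter space. -/
lemma tendsto_tricomiGeneric (a c w s : ℂ) {r : ℂ} (hr : r ≠ 0) :
    Tendsto (fun t : ℂ => tricomiGeneric (a + s * t) (c + r * t) w) (𝓝[≠] 0)
      (𝓝 (tricomi a c w)) := by
  by_cases hc : Complex.sin (Real.pi * c) = 0
  · obtain ⟨n, rfl⟩ := (sin_pi_mul_eq_zero_iff c).mp hc
    rw [tricomi_int]
    exact tendsto_tricomiGeneric_int a w s n hr
  · have h1 := (hasDerivAt_tricomiNum a c s r w).continuousAt
    have h2 := (hasDerivAt_sin_line c r).continuousAt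
    have h3 := ((continuousAt_const (y := (Real.pi : ℂ))).div h2 (by simpa using hc)).mul h1
    have h4 := h3.tendsto.mono_left (nhdsWithin_le_nhds (s := {0}ᶜ))
    simp only [Pi.mul_apply, Pi.div_apply, mul_zero, add_zero] at h4
    rw [tricomi_of_sin_ne_zero a w hc]
    refine h4.congr fun t => ?_
    rw [tricomiGeneric_eq]
    rfl

lemma tricomi_symm (a c w : ℂ) :
    tricomi (1 + a - c) (2 - c) w = Complex.exp ((c - 1) * w) * tricomi a c w := by
  have h1 := tendsto_tricomiGeneric (1 + a - c) (2 - c) w (-1) (neg_ne_zero.mpr one_ne_zero)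
  have h2 := tendsto_tricomiGeneric a c w 0 one_ne_zero
  have h3 : Tendsto (fun t : ℂ => Complex.exp ((c + 1 * t - 1) * w)) (𝓝[≠] 0)
      (𝓝 (Complex.exp ((c - 1) * w))) := by
    have : Continuous fun t : ℂ => Complex.exp ((c + 1 * t - 1) * w) := by fun_prop
    simpa using (this.tendsto 0).mono_left nhdsWithin_le_nhds
  refine tendsto_nhds_unique h1 ((h3.mul h2).congr fun t => ?_)
  rw [tricomiGeneric_eq, tricomiGeneric_eq,
    show 1 + a - c + -1 * t = 1 + (a + 0 * t) - (c + 1 * t) by ring,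
    show 2 - c + -1 * t = 2 - (c + 1 * t) by ring, tricomiNum_symm,
    show (Real.pi : ℂ) * (2 - (c + 1 * t)) = 2 * Real.pi - Real.pi * (c + 1 * t) by ring,
    Complex.sin_two_pi_sub]
  ring

/-! ### Connection formula and monodromy -/

lemma rGamma_mul_of_add_eq {a b : ℂ} (h : a + b = 1) :
    rGamma a * rGamma b = Complex.sin (Real.pi * a) / Real.pi := by
  rw [← rGamma_mul_rGamma_one_sub, ← h, add_sub_cancel_left]

/-- The second Tricomi function has argument `-x`; Kummer's transformation brings both its terms
back to argument `x`. The terms with `x^(1-c)` cancel, and the others add up by `e^(iπa) sin π(c-a)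
+ e^(-iπ(c-a)) sin πa = sin πc`. -/
lemma kummerR_eq_generic (a w : ℂ) {c : ℂ} (hc : Complex.sin (Real.pi * c) ≠ 0) :
    kummerR a c (Complex.exp w) =
      Complex.exp (Complex.I * Real.pi * a) * rGamma (c - a) * tricomiGeneric a c w
        + Complex.exp (-(Complex.I * Real.pi * (c - a))) * rGamma a * Complex.exp (Complex.exp w)
          * tricomiGeneric (c - a) c (w - Real.pi * Complex.I) := by
  have hpi : (Real.pi : ℂ) ≠ 0 := by exact_mod_cast Real.pi_ne_zero
  have hx : Complex.exp (w - Real.pi * Complex.I) = -Complex.exp w := Complex.exp_sub_pi_mul_I w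
  have hk1 := kummerR_eq_exp_mul a c (Complex.exp w)
  have hk2 := kummerR_eq_exp_mul (1 + a - c) (2 - c) (Complex.exp w)
  rw [show 2 - c - (1 + a - c) = 1 - a by ring] at hk2
  have hg1 := rGamma_mul_of_add_eq (a := c - a) (b := 1 + a - c) (by ring)
  have hg2 := rGamma_mul_rGamma_one_sub a
  have he1 : Complex.exp ((1 - c) * (w - Real.pi * Complex.I))
      = -Complex.exp ((1 - c) * w) * Complex.exp (Complex.I * Real.pi * c) := by
    rw [show (1 - c) * (w - Real.pi * Complex.I)
      = (1 - c) * w + Complex.I * Real.pi * c - Real.pi * Complex.I by ring,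
      Complex.exp_sub_pi_mul_I, Complex.exp_add]
    ring
  have he2 : Complex.exp (-(Complex.I * Real.pi * (c - a))) * Complex.exp (Complex.I * Real.pi * c)
      = Complex.exp (Complex.I * Real.pi * a) := by
    rw [← Complex.exp_add]
    ring_nf
  have htrig : Complex.exp (Complex.I * Real.pi * a) * Complex.sin (Real.pi * (c - a))
      + Complex.exp (-(Complex.I * Real.pi * (c - a))) * Complex.sin (Real.pi * a)
      = Complex.sin (Real.pi * c) := by
    rw [show -(Complex.I * Real.pi * (c - a)) = Complex.I * Real.pi * (-(c - a)) by ring,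
      exp_pi_mul_I_eq, exp_pi_mul_I_eq, mul_neg, Complex.cos_neg, Complex.sin_neg,
      show (Real.pi : ℂ) * c = Real.pi * a + Real.pi * (c - a) by ring, Complex.sin_add]
    ring
  rw [tricomiGeneric_eq, tricomiGeneric_eq, tricomiNum, tricomiNum, hx, he1,
    show 1 + (c - a) - c = 1 - a by ring]
  have hmain : Real.pi * (rGamma (c - a) * rGamma (1 + a - c)) = Complex.sin (Real.pi * (c - a)) := by
    rw [hg1]; field_simp
  have hmain2 : Real.pi * (rGamma a * rGamma (1 - a)) = Complex.sin (Real.pi * a) := by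
    rw [hg2]; field_simp
  set X := Complex.exp ((1 - c) * w)
  set E := Complex.exp (Complex.I * Real.pi * a)
  set F := Complex.exp (-(Complex.I * Real.pi * (c - a)))
  set P := Complex.exp (Complex.I * Real.pi * c)
  set R1 := kummerR a c (Complex.exp w)
  set R2 := kummerR (1 + a - c) (2 - c) (Complex.exp w)
  set Q1 := kummerR (c - a) c (-Complex.exp w)
  set Q2 := kummerR (1 - a) (2 - c) (-Complex.exp w)
  set Y := Complex.exp (Complex.exp w)
  set S := Complex.sin (Real.pi * c)
  have goal : S * R1 = E * rGamma (c - a) * (Real.pi * (R1 * rGamma (1 + a - c) - X * R2 * rGamma a))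
      + F * rGamma a * Y * (Real.pi * (Q1 * rGamma (1 - a) - -X * P * Q2 * rGamma (c - a))) := by
    linear_combination (-R1) * htrig - (E * R1) * hmain - (F * R1) * hmain2
      + (Real.pi * F * rGamma a * rGamma (1 - a)) * hk1
      + (Real.pi * F * P * X * rGamma a * rGamma (c - a)) * hk2
      - (Real.pi * X * R2 * rGamma a * rGamma (c - a)) * he2
  field_simp
  linear_combination goal

lemma tendsto_rGamma_line (u v : ℂ) :
    Tendsto (fun t : ℂ => rGamma (u + v * t)) (𝓝[≠] 0) (𝓝 (rGamma u)) := by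
  have : Continuous fun t : ℂ => rGamma (u + v * t) :=
    differentiable_rGamma.continuous.comp (by fun_prop)
  simpa using (this.tendsto 0).mono_left nhdsWithin_le_nhds

/-- Connection formula between Kummer's and Tricomi's functions. -/
lemma kummerR_eq_tricomi (a c w : ℂ) :
    kummerR a c (Complex.exp w) =
      Complex.exp (Complex.I * Real.pi * a) * rGamma (c - a) * tricomi a c w
        + Complex.exp (-(Complex.I * Real.pi * (c - a))) * rGamma a * Complex.exp (Complex.exp w)
          * tricomi (c - a) c (w - Real.pi * Complex.I) := by
  have h0 := (hasDerivAt_kummerR a c 0 1 (Complex.exp w)).continuousAt.tendsto.mono_left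
    (nhdsWithin_le_nhds (s := {0}ᶜ))
  simp only [mul_zero, add_zero] at h0
  have h1 := tendsto_tricomiGeneric a c w 0 one_ne_zero
  -- With `a` fixed, `c - a` moves along with `c`, so the limit is needed in the direction `(1, 1)`.
  have h2 := tendsto_tricomiGeneric (c - a) c (w - Real.pi * Complex.I) 1 one_ne_zero
  have h3 := tendsto_rGamma_line (c - a) 1
  have h4 : Tendsto (fun t : ℂ => Complex.exp (-(Complex.I * Real.pi * (c - a + 1 * t)))) (𝓝[≠] 0)
      (𝓝 (Complex.exp (-(Complex.I * Real.pi * (c - a))))) := by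
    have : Continuous fun t : ℂ => Complex.exp (-(Complex.I * Real.pi * (c - a + 1 * t))) := by
      fun_prop
    simpa using (this.tendsto 0).mono_left nhdsWithin_le_nhds
  refine tendsto_nhds_unique h0 (Tendsto.congr' ?_
    (((h3.const_mul (Complex.exp (Complex.I * Real.pi * a))).mul h1).add
      (((h4.mul_const (rGamma a)).mul_const (Complex.exp (Complex.exp w))).mul h2)))
  filter_upwards [eventually_sin_line_ne_zero c one_ne_zero] with t ht
  have h := kummerR_eq_generic (a + 0 * t) w ht
  rw [show c + 1 * t - (a + 0 * t) = c - a + 1 * t by ring] at h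
  rw [h]
  simp only [zero_mul, add_zero]

/-- A turn only multiplies the term with `x^(1-c)` by `e^(-2πic)`. After multiplication by
`e^(2πic)` the difference is `e^(2πic) - 1` times the other term, and `e^(2πic) - 1 = 2i e^(iπc) sin
πc` removes the denominator, so the formula survives at integer `c`. -/
lemma tricomiGeneric_monodromy (b w : ℂ) {c : ℂ} (hc : Complex.sin (Real.pi * c) ≠ 0) :
    Complex.exp (2 * (Complex.I * Real.pi * c)) * tricomiGeneric b c (w + 2 * Real.pi * Complex.I)
      = tricomiGeneric b c w + 2 * Real.pi * Complex.I * Complex.exp (Complex.I * Real.pi * c)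
        * rGamma (1 + b - c) * kummerR b c (Complex.exp w) := by
  have hx : Complex.exp (w + 2 * Real.pi * Complex.I) = Complex.exp w := Complex.exp_periodic w
  have he : Complex.exp (2 * (Complex.I * Real.pi * c))
      * Complex.exp ((1 - c) * (w + 2 * Real.pi * Complex.I)) = Complex.exp ((1 - c) * w) := by
    rw [← Complex.exp_add, show 2 * (Complex.I * Real.pi * c) +
      (1 - c) * (w + 2 * Real.pi * Complex.I) = (1 - c) * w + 2 * Real.pi * Complex.I by ring]
    exact Complex.exp_periodic _
  have htrig : Complex.exp (2 * (Complex.I * Real.pi * c)) - 1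
      = 2 * Complex.I * Complex.exp (Complex.I * Real.pi * c) * Complex.sin (Real.pi * c) := by
    have h2 : Complex.exp (2 * (Complex.I * Real.pi * c))
        = Complex.exp (Complex.I * Real.pi * c) ^ 2 := by
      rw [← Complex.exp_nat_mul]; norm_num
    rw [h2, exp_pi_mul_I_eq]
    have := Complex.sin_sq_add_cos_sq (Real.pi * c)
    linear_combination this + (-Complex.sin (Real.pi * c) ^ 2) * Complex.I_sq
  rw [tricomiGeneric_eq, tricomiGeneric_eq, tricomiNum, tricomiNum, hx]
  set F := Complex.exp (2 * (Complex.I * Real.pi * c))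
  set E := Complex.exp (Complex.I * Real.pi * c)
  set X := Complex.exp ((1 - c) * (w + 2 * Real.pi * Complex.I))
  field_simp
  linear_combination (kummerR b c (Complex.exp w) * rGamma (1 + b - c)) * htrig
    - (kummerR (1 + b - c) (2 - c) (Complex.exp w) * rGamma b) * he

/-- Monodromy of Tricomi's function at the origin. -/
lemma tricomi_monodromy (b c w : ℂ) :
    Complex.exp (2 * (Complex.I * Real.pi * c)) * tricomi b c (w + 2 * Real.pi * Complex.I)
      = tricomi b c w + 2 * Real.pi * Complex.I * Complex.exp (Complex.I * Real.pi * c)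
        * rGamma (1 + b - c) * kummerR b c (Complex.exp w) := by
  have h0 := (hasDerivAt_kummerR b c 0 1 (Complex.exp w)).continuousAt.tendsto.mono_left
    (nhdsWithin_le_nhds (s := {0}ᶜ))
  simp only [mul_zero, add_zero] at h0
  have h1 := tendsto_tricomiGeneric b c w 0 one_ne_zero
  have h2 := tendsto_tricomiGeneric b c (w + 2 * Real.pi * Complex.I) 0 one_ne_zero
  have h3 := tendsto_rGamma_line (1 + b - c) (-1)
  have h4 : ∀ k : ℂ, Tendsto (fun t : ℂ => Complex.exp (k * (Complex.I * Real.pi * (c + 1 * t))))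
      (𝓝[≠] 0) (𝓝 (Complex.exp (k * (Complex.I * Real.pi * c)))) := by
    intro k
    have : Continuous fun t : ℂ => Complex.exp (k * (Complex.I * Real.pi * (c + 1 * t))) := by
      fun_prop
    simpa using (this.tendsto 0).mono_left nhdsWithin_le_nhds
  have h5 := h4 1
  simp only [one_mul] at h5
  refine tendsto_nhds_unique ((h4 2).mul h2) (Tendsto.congr' ?_
    (h1.add (((h5.const_mul (2 * Real.pi * Complex.I)).mul h3).mul h0)))
  filter_upwards [eventually_sin_line_ne_zero c one_ne_zero] with t ht
  rw [one_mul] at ht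
  have h := tricomiGeneric_monodromy (b + 0 * t) w ht
  rw [show 1 + (b + 0 * t) - (c + t) = 1 + b - c + -1 * t by ring] at h
  simpa using h.symm

lemma kummerR_zero (a c : ℂ) : kummerR a c 0 = rGamma c := by
  rw [kummerR, tsum_eq_single 0 (fun n hn => by simp [hn])]
  simp [kummerCoeff, rising_zero]

/-- The structure of Tricomi's function at the origin. -/
lemma exists_tricomi_eq (a : ℂ) {c : ℂ} (hc : 0 < c.re) :
    ∃ A B E : ℂ → ℂ, Differentiable ℂ A ∧ Differentiable ℂ B ∧ Differentiable ℂ E ∧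
      (c ≠ 1 → E 0 = 0) ∧ ∀ w, tricomi a c w = A (Complex.exp w)
        + Complex.exp ((1 - c) * w) * (B (Complex.exp w) + w * E (Complex.exp w)) := by
  by_cases h : Complex.sin (Real.pi * c) = 0
  · obtain ⟨n, rfl⟩ := (sin_pi_mul_eq_zero_iff c).mp h
    set q : ℂ := (Complex.cos (Real.pi * n))⁻¹
    -- The logarithmic term `E` comes from differentiating `exp((1-c)w)` in `c`.
    refine ⟨fun x => q * (kummerRDerivC a n x * rGamma (1 + a - n)
        - kummerR a n x * deriv rGamma (1 + a - n)),
      fun x => q * ((kummerRDerivA (1 + a - n) (2 - n) x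
        + kummerRDerivC (1 + a - n) (2 - n) x) * rGamma a),
      fun x => q * (kummerR (1 + a - n) (2 - n) x * rGamma a), ?_, ?_, ?_, ?_, ?_⟩
    · exact (((differentiable_kummerRDerivC _ _).mul_const _).sub
        ((differentiable_kummerR _ _).mul_const _)).const_mul q
    · exact (((differentiable_kummerRDerivA _ _).add
        (differentiable_kummerRDerivC _ _)).mul_const _).const_mul q
    · exact ((differentiable_kummerR _ _).mul_const _).const_mul q
    -- `Re c > 0` and `c ≠ 1` leave the integers `c ≥ 2`. There `2 - c` is a pole of `Γ`, so the
    -- regularized series with second parameter `2 - c` vanishes at `x = 0`.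
    · intro hn
      have hn0 : 0 < n := by simpa using hc
      have hn1 : n ≠ 1 := fun h => hn (by simp [h])
      obtain ⟨k, hk⟩ := Int.eq_ofNat_of_zero_le (show 0 ≤ n - 2 by omega)
      have : (2 - n : ℂ) = -(k : ℂ) := by
        have : n = k + 2 := by omega
        rw [this]
        push_cast
        ring
      simp only [kummerR_zero]
      rw [this, rGamma_neg_nat]
      simp
    · intro w
      rw [tricomi_int, tricomiNumDerivC, div_eq_mul_inv]
      ring
  · set q : ℂ := Real.pi / Complex.sin (Real.pi * c)
    refine ⟨fun x => q * (kummerR a c x * rGamma (1 + a - c)),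
      fun x => -q * (kummerR (1 + a - c) (2 - c) x * rGamma a), fun _ => 0, ?_, ?_,
      differentiable_const 0, fun _ => rfl, fun w => ?_⟩
    · exact ((differentiable_kummerR _ _).mul_const _).const_mul q
    · exact ((differentiable_kummerR _ _).mul_const _).const_mul (-q)
    · rw [tricomi_of_sin_ne_zero a w h, tricomiNum]
      ring

/-! ### Rows of the model solution on the universal covering -/

lemma expPi_add (x y : ℂ) : expPi (x + y) = expPi x * expPi y := by
  rw [expPi, expPi, expPi, ← Complex.exp_add, mul_add]

lemma expPi_one : expPi 1 = -1 := by
  rw [expPi, mul_one, mul_comm]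
  exact Complex.exp_pi_mul_I

lemma expPi_ne_zero (x : ℂ) : expPi x ≠ 0 := Complex.exp_ne_zero _

lemma expPi_neg (x : ℂ) : expPi (-x) = (expPi x)⁻¹ := by
  rw [expPi, expPi, mul_neg, Complex.exp_neg]

lemma expPi_sub (x y : ℂ) : expPi (x - y) = expPi x * (expPi y)⁻¹ := by
  rw [sub_eq_add_neg, expPi_add, expPi_neg]

lemma expPi_two_mul (x : ℂ) : expPi (2 * x) = expPi x ^ 2 := by
  rw [two_mul, expPi_add, sq]

/-- The neighbourhoods of the origin on the sheets with `|arg| ≤ 2π` of the universal covering. -/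
def originFilter : Filter ℂ :=
  comap Complex.re atBot ⊓ 𝓟 {w | |w.im| ≤ 2 * Real.pi}

lemma tendsto_re_originFilter : Tendsto Complex.re originFilter atBot :=
  tendsto_comap.mono_left inf_le_left

lemma tendsto_exp_originFilter : Tendsto Complex.exp originFilter (𝓝 0) := by
  rw [tendsto_zero_iff_norm_tendsto_zero]
  simp only [Complex.norm_exp]
  exact Real.tendsto_exp_atBot.comp tendsto_re_originFilter

lemma eventually_norm_le_originFilter :
    ∀ᶠ w in originFilter, 1 ≤ |w.re| ∧ ‖w‖ ≤ 2 * |w.re| := by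
  -- Below `-2π` the real part dominates the imaginary part, which gives the factor `2`.
  have h1 := tendsto_re_originFilter.eventually (eventually_le_atBot (-(2 * Real.pi)))
  have h2 : ∀ᶠ w in originFilter, |w.im| ≤ 2 * Real.pi :=
    mem_inf_of_right (mem_principal_self _)
  filter_upwards [h1, h2] with w hw1 hw2
  have hpi := Real.pi_gt_three
  have h3 : |w.re| = -w.re := abs_of_nonpos (by linarith)
  refine ⟨by linarith, (Complex.norm_le_abs_re_add_abs_im w).trans (by linarith)⟩

lemma isBigO_id_originFilter : (fun w : ℂ => w) =O[originFilter] fun w => w.re := by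
  refine IsBigO.of_bound 2 ?_
  filter_upwards [eventually_norm_le_originFilter] with w hw
  exact hw.2

lemma isBigO_one_originFilter : (fun _ : ℂ => (1 : ℂ)) =O[originFilter] fun w => w.re := by
  refine IsBigO.of_bound 1 ?_
  filter_upwards [eventually_norm_le_originFilter] with w hw
  simpa using hw.1

lemma isBigO_mul_exp_originFilter :
    (fun w : ℂ => w * Complex.exp w) =O[originFilter] fun _ => (1 : ℂ) := by
  refine IsBigO.of_bound 2 ?_
  filter_upwards [eventually_norm_le_originFilter,
    tendsto_re_originFilter.eventually (eventually_le_atBot 0)] with w hw hw0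
  rw [norm_mul, Complex.norm_exp, norm_one, mul_one]
  have h1 : |w.re| * Real.exp w.re ≤ 1 := by
    rw [abs_of_nonpos hw0, ← le_div_iff₀ (Real.exp_pos _), one_div, ← Real.exp_neg]
    linarith [Real.add_one_le_exp (-w.re)]
  nlinarith [mul_le_mul_of_nonneg_right hw.2 (Real.exp_pos w.re).le]

lemma isBigO_comp_exp_originFilter {A : ℂ → ℂ} (hA : Differentiable ℂ A) :
    (fun w => A (Complex.exp w)) =O[originFilter] fun _ => (1 : ℂ) :=
  ((hA.continuous.tendsto 0).comp tendsto_exp_originFilter).isBigO_one ℂ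

/-- A zero at the origin beats the logarithm: `A(x) = O(x)`, and `x log x` stays bounded on finitely
many sheets. -/
lemma isBigO_mul_comp_exp_originFilter {A : ℂ → ℂ} (hA : Differentiable ℂ A) (h0 : A 0 = 0) :
    (fun w => w * A (Complex.exp w)) =O[originFilter] fun _ => (1 : ℂ) := by
  have h1 : A =O[𝓝 0] fun x => x := by simpa [h0] using (hA 0).isBigO_sub
  have h2 := h1.comp_tendsto tendsto_exp_originFilter
  exact ((isBigO_refl (fun w : ℂ => w) _).mul h2).trans isBigO_mul_exp_originFilter

/-- Functions with the singularity of Tricomi's function at the origin. -/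
def HasTricomiForm (α : ℂ) (f : ℂ → ℂ) : Prop :=
  ∃ A B E : ℂ → ℂ, Differentiable ℂ A ∧ Differentiable ℂ B ∧ Differentiable ℂ E ∧
    (α ≠ 0 → E 0 = 0) ∧ ∀ w, f w = Complex.exp (α * w) * A (Complex.exp w)
      + Complex.exp (-α * w) * (B (Complex.exp w) + w * E (Complex.exp w))

lemma HasTricomiForm.differentiable {α : ℂ} {f : ℂ → ℂ} (h : HasTricomiForm α f) :
    Differentiable ℂ f := by
  obtain ⟨A, B, E, hA, hB, hE, -, hf⟩ := h
  rw [funext hf]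
  have he := Complex.differentiable_exp (𝕜 := ℂ)
  exact ((he.comp (differentiable_id.const_mul α)).mul (hA.comp he)).add
    ((he.comp (differentiable_id.const_mul (-α))).mul
      ((hB.comp he).add (differentiable_id.mul (hE.comp he))))

lemma HasTricomiForm.isBigO {α : ℂ} {f : ℂ → ℂ} (h : HasTricomiForm α f) (hα : α ≠ 0) :
    f =O[originFilter] fun w => ‖Complex.exp (α * w)‖ + ‖Complex.exp (-α * w)‖ := by
  obtain ⟨A, B, E, hA, hB, hE, hE0, hf⟩ := h
  rw [funext hf]
  have h1 := (isBigO_refl (fun w => Complex.exp (α * w)) originFilter).mul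
    (isBigO_comp_exp_originFilter hA)
  have h2 := (isBigO_refl (fun w => Complex.exp (-α * w)) originFilter).mul
    ((isBigO_comp_exp_originFilter hB).add (isBigO_mul_comp_exp_originFilter hE (hE0 hα)))
  simp only [mul_one] at h1 h2
  refine (h1.trans (IsBigO.of_norm_le fun w => ?_)).add
    (h2.trans (IsBigO.of_norm_le fun w => ?_)) <;> simp

lemma HasTricomiForm.isBigO_log {f : ℂ → ℂ} (h : HasTricomiForm 0 f) :
    f =O[originFilter] fun w => w.re := by
  obtain ⟨A, B, E, hA, hB, hE, -, hf⟩ := h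
  rw [funext hf]
  simp only [neg_zero, zero_mul, Complex.exp_zero, one_mul]
  have h1 := (isBigO_comp_exp_originFilter hA).trans isBigO_one_originFilter
  have h2 := (isBigO_comp_exp_originFilter hB).trans isBigO_one_originFilter
  have h3 := isBigO_id_originFilter.mul (isBigO_comp_exp_originFilter hE).norm_right
  simp only [norm_one, mul_one] at h3
  exact h1.add (h2.add h3)

/-- For `c = 1 + 2α` the factor `x^α` turns the exponents `0` and `1 - c` into `α` and `-α`. The
condition on `Re α` says that `Re c > 0`. -/
lemma hasTricomiForm_tricomi (a K : ℂ) {α : ℂ} (hα : -(1 / 2 : ℝ) < α.re) {Y : ℂ → ℂ}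
    (hY : Differentiable ℂ Y) :
    HasTricomiForm α fun w =>
      K * Complex.exp (α * w) * Y (Complex.exp w) * tricomi a (1 + 2 * α) w := by
  have hc : 0 < (1 + 2 * α).re := by
    simp
    linarith
  obtain ⟨A, B, E, hA, hB, hE, hE0, h⟩ := exists_tricomi_eq a hc
  refine ⟨fun x => K * Y x * A x, fun x => K * Y x * B x, fun x => K * Y x * E x,
    (hY.const_mul K).mul hA, (hY.const_mul K).mul hB, (hY.const_mul K).mul hE,
    fun h0 => by simp [hE0 (by simpa using h0)], fun w => ?_⟩
  have he : Complex.exp (α * w) * Complex.exp ((1 - (1 + 2 * α)) * w) = Complex.exp (-α * w) := by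
    rw [← Complex.exp_add]
    ring_nf
  beta_reduce
  rw [h]
  linear_combination
    (K * Y (Complex.exp w) * (B (Complex.exp w) + w * E (Complex.exp w))) * he

/-- The shift by `-iπ` replaces `x` by `-x`, multiplies `x^(±α)` by constants, and moves a multiple
of `E` into `B`. -/
lemma hasTricomiForm_tricomi_sub_pi (a K : ℂ) {α : ℂ} (hα : -(1 / 2 : ℝ) < α.re) {Y : ℂ → ℂ}
    (hY : Differentiable ℂ Y) :
    HasTricomiForm α fun w => K * Complex.exp (α * w) * Y (Complex.exp w)
      * tricomi a (1 + 2 * α) (w - Real.pi * Complex.I) := by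
  obtain ⟨A, B, E, hA, hB, hE, hE0, h⟩ :=
    hasTricomiForm_tricomi a (K * Complex.exp (α * (Real.pi * Complex.I))) hα
      (hY.comp differentiable_neg)
  have hn : Differentiable ℂ fun x : ℂ => -x := differentiable_neg
  set p := Complex.exp (-α * (Real.pi * Complex.I))
  set q := Complex.exp (α * (Real.pi * Complex.I))
  refine ⟨fun x => p * A (-x), fun x => q * (B (-x) - Real.pi * Complex.I * E (-x)),
    fun x => q * E (-x), (hA.comp hn).const_mul p,
    ((hB.comp hn).sub ((hE.comp hn).const_mul _)).const_mul q, (hE.comp hn).const_mul q,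
    fun h0 => by simp [hE0 h0], fun w => ?_⟩
  have hx : Complex.exp (w - Real.pi * Complex.I) = -Complex.exp w := Complex.exp_sub_pi_mul_I w
  have h1 : Complex.exp (α * (w - Real.pi * Complex.I)) = Complex.exp (α * w) * p := by
    rw [← Complex.exp_add]
    ring_nf
  have h2 : Complex.exp (-α * (w - Real.pi * Complex.I)) = Complex.exp (-α * w) * q := by
    rw [← Complex.exp_add]
    ring_nf
  have hpq : q * p = 1 := by
    rw [← Complex.exp_add, neg_mul, add_neg_cancel, Complex.exp_zero]
  have hw := h (w - Real.pi * Complex.I)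
  simp only [Function.comp, hx, h1, h2, neg_neg] at hw
  linear_combination hw - (K * Complex.exp (α * w) * Y (Complex.exp w)
    * tricomi a (1 + 2 * α) (w - Real.pi * Complex.I)) * hpq

/-- The properties of the two functions in a row of the solution in sector `I`, continued to the
universal covering of the punctured plane. -/
structure IsModelRow (α β : ℂ) (f g : ℂ → ℂ) : Prop where
  form_left : HasTricomiForm α f
  form_right : HasTricomiForm α g
  monodromy_sum : ∀ w, f (w + 2 * Real.pi * Complex.I)
      + expPi (β - 2 * α) * g (w + 2 * Real.pi * Complex.I)
    = expPi (2 * α) * (f w + expPi (β - 2 * α) * g w)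
  monodromy_right : ∀ w, g (w + 2 * Real.pi * Complex.I)
    = expPi (β + 2 * α) * (f w + expPi (β - 2 * α) * g w) - expPi (-β) * f w
  isBigO_sum : (fun w => f w + expPi (β - 2 * α) * g w) =O[originFilter]
    fun w => Complex.exp (α * w)

/-- The first function of a row, with parameter `a` and normalization `K`. -/
def modelRowLeft (α a K w : ℂ) : ℂ :=
  K * (expPi a * rGamma (1 + 2 * α - a)) * Complex.exp (α * w)
    * Complex.exp (-Complex.exp w / 2) * tricomi a (1 + 2 * α) w

/-- The second function of a row, with parameter `a` and normalization `K`. -/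
def modelRowRight (α β a K w : ℂ) : ℂ :=
  K * (expPi (-(β - 2 * α) - (1 + 2 * α - a)) * rGamma a) * Complex.exp (α * w)
    * Complex.exp (Complex.exp w / 2)
    * tricomi (1 + 2 * α - a) (1 + 2 * α) (w - Real.pi * Complex.I)

/-- The constants are chosen so that the connection formula collapses the combination of `f` and `g`
to `x^α` times an entire function of `x`, which gives its monodromy and its bound. A turn adds to
`g` a multiple of `M(c-a, c, -x)`, which by Kummer's transformation is again a multiple of that
combination. -/
lemma isModelRow_tricomi {α β : ℂ} (hα : -(1 / 2 : ℝ) < α.re) (K : ℂ) {a : ℂ}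
    (ha : expPi (2 * a) = expPi (2 * α + 2 * β)) :
    IsModelRow α β (modelRowLeft α a K) (modelRowRight α β a K) := by
  unfold modelRowLeft modelRowRight
  set c := 1 + 2 * α with hc
  have hexp2 : ∀ w : ℂ, Complex.exp (w + 2 * Real.pi * Complex.I) = Complex.exp w :=
    Complex.exp_periodic
  have hα2 : ∀ w : ℂ, Complex.exp (α * (w + 2 * Real.pi * Complex.I))
      = expPi (2 * α) * Complex.exp (α * w) := fun w => by
    rw [expPi, ← Complex.exp_add]
    ring_nf
  have hy : ∀ x : ℂ, Complex.exp (x / 2) = Complex.exp (-x / 2) * Complex.exp x := fun x => by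
    rw [← Complex.exp_add]
    ring_nf
  have hsum : ∀ w, K * (expPi a * rGamma (c - a)) * Complex.exp (α * w)
        * Complex.exp (-Complex.exp w / 2) * tricomi a c w
      + expPi (β - 2 * α) * (K * (expPi (-(β - 2 * α) - (c - a)) * rGamma a) * Complex.exp (α * w)
        * Complex.exp (Complex.exp w / 2)
        * tricomi (c - a) c (w - Real.pi * Complex.I))
      = Complex.exp (α * w)
        * (K * Complex.exp (-Complex.exp w / 2) * kummerR a c (Complex.exp w)) := by
    intro w
    have h1 := kummerR_eq_tricomi a c w
    have h2 : expPi (β - 2 * α) * expPi (-(β - 2 * α) - (c - a))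
        = Complex.exp (-(Complex.I * Real.pi * (c - a))) := by
      rw [← expPi_add, expPi]
      ring_nf
    rw [h1, hy (Complex.exp w), ← h2]
    simp only [expPi]
    ring
  refine ⟨hasTricomiForm_tricomi a _ hα (Y := fun x => Complex.exp (-x / 2)) (by fun_prop),
    hasTricomiForm_tricomi_sub_pi (c - a) _ hα (Y := fun x => Complex.exp (x / 2)) (by fun_prop),
    fun w => ?_, fun w => ?_, ?_⟩
  · rw [hsum, hsum, hexp2, hα2]
    ring
  · rw [hsum, hexp2, hα2]
    have hm := tricomi_monodromy (c - a) c (w - Real.pi * Complex.I)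
    have hx : Complex.exp (w - Real.pi * Complex.I) = -Complex.exp w :=
      Complex.exp_sub_pi_mul_I w
    have hk := kummerR_eq_exp_mul a c (Complex.exp w)
    have hg := rGamma_mul_rGamma_one_sub a
    have hpi : (Real.pi : ℂ) ≠ 0 := by exact_mod_cast Real.pi_ne_zero
    rw [eq_div_iff hpi] at hg
    have hc2 : Complex.exp (2 * (Complex.I * Real.pi * c)) = expPi (2 * α) ^ 2 := by
      rw [show 2 * (Complex.I * Real.pi * c) = 2 * (Complex.I * Real.pi * (2 * α))
        + 2 * Real.pi * Complex.I by rw [hc]; ring, Complex.exp_periodic, two_mul (_ * _),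
        Complex.exp_add, sq, expPi]
    have hc1 : Complex.exp (Complex.I * Real.pi * c) = -expPi (2 * α) := by
      change expPi c = _
      rw [hc, expPi_add, expPi_one, neg_one_mul]
    have hL : expPi (-(β - 2 * α) - (c - a)) = -expPi (a - β) := by
      rw [show -(β - 2 * α) - (c - a) = (a - β) - 1 by rw [hc]; ring, expPi_sub, expPi_one]
      norm_num
    -- The reflection formula for `Γ(a)` produces `sin πa`. The hypothesis on `e^(2πia)` makes the
    -- coefficient the same for both rows.
    have hsin : 2 * Complex.I * expPi (a - β) * Complex.sin (Real.pi * a)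
        = expPi (β + 2 * α) - expPi (-β) := by
      have h1 : expPi (a - β) * expPi a = expPi (β + 2 * α) := by
        rw [← expPi_add, show a - β + a = 2 * a - β by ring, expPi_sub, ha, ← expPi_neg,
          ← expPi_add]
        ring_nf
      have h2 : expPi (a - β) * expPi (-a) = expPi (-β) := by
        rw [← expPi_add]
        ring_nf
      have h3 : expPi a = Complex.cos (Real.pi * a) + Complex.I * Complex.sin (Real.pi * a) :=
        exp_pi_mul_I_eq a
      have h4 : expPi (-a) = Complex.cos (Real.pi * a) - Complex.I * Complex.sin (Real.pi * a) := by
        rw [expPi, exp_pi_mul_I_eq, mul_neg, Complex.cos_neg, Complex.sin_neg]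
        ring
      rw [← h1, ← h2, h3, h4]
      ring
    have hs := hsum w
    rw [hx, hc2, hc1, show 1 + (c - a) - c = 1 - a by ring,
      show w - Real.pi * Complex.I + 2 * Real.pi * Complex.I
        = w + 2 * Real.pi * Complex.I - Real.pi * Complex.I by ring] at hm
    rw [hL] at hs ⊢
    rw [hy (Complex.exp w)] at hs ⊢
    have hr : expPi (β - 2 * α) * expPi (-β) = (expPi (2 * α))⁻¹ := by
      rw [← expPi_neg, ← expPi_add]
      ring_nf
    have hp := expPi_ne_zero (2 * α)
    set P := expPi (2 * α)
    set U' := tricomi (c - a) c (w + 2 * Real.pi * Complex.I - Real.pi * Complex.I)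
    set U := tricomi (c - a) c (w - Real.pi * Complex.I)
    set V := tricomi a c w
    set y := Complex.exp (-Complex.exp w / 2)
    set x := Complex.exp (Complex.exp w)
    set X := Complex.exp (α * w)
    set R := kummerR a c (Complex.exp w)
    set Rb := kummerR (c - a) c (-Complex.exp w)
    have hm' : P * U' = P⁻¹ * U - 2 * Real.pi * Complex.I * rGamma (1 - a) * Rb := by
      field_simp
      linear_combination hm
    linear_combination (-K * expPi (a - β) * rGamma a * X * y * x) * hm'
      + (2 * Complex.I * K * expPi (a - β) * X * y * x * Rb) * hg
      + (K * X * y * x * Rb) * hsin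
      + (-(expPi (β + 2 * α) - expPi (-β)) * K * X * y) * hk
      + expPi (-β) * hs
      + (K * expPi (a - β) * rGamma a * X * y * x * U) * hr
  · simp only [hsum]
    have h := (isBigO_refl (fun w => Complex.exp (α * w)) originFilter).mul
      (isBigO_comp_exp_originFilter (A := fun x => K * Complex.exp (-x / 2) * kummerR a c x)
        (((by fun_prop : Differentiable ℂ fun x : ℂ => K * Complex.exp (-x / 2))).mul
          (differentiable_kummerR a c)))
    simpa only [mul_one] using h

/-! ### The explicit solution on the sheet `0 < arg ζ < 2π` -/

lemma exp_logBranch {ζ : ℂ} (h : ζ ≠ 0) : Complex.exp (logBranch ζ) = ζ := by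
  rw [logBranch, Complex.exp_add_pi_mul_I, Complex.exp_log (neg_ne_zero.mpr h), neg_neg]

lemma logBranch_re (ζ : ℂ) : (logBranch ζ).re = Real.log ‖ζ‖ := by
  simp [logBranch, Complex.log_re]

lemma argBranch_eq (ζ : ℂ) : argBranch ζ = Complex.arg (-ζ) + Real.pi := by
  simp [argBranch, logBranch, Complex.log_im]

lemma argBranch_pos (ζ : ℂ) : 0 < argBranch ζ := by
  rw [argBranch_eq]
  linarith [Complex.neg_pi_lt_arg (-ζ)]

lemma argBranch_le (ζ : ℂ) : argBranch ζ ≤ 2 * Real.pi := by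
  rw [argBranch_eq]
  linarith [Complex.arg_le_pi (-ζ)]

lemma neg_mem_slitPlane {ζ : ℂ} (h0 : ζ ≠ 0) (h : argBranch ζ < 2 * Real.pi) :
    -ζ ∈ Complex.slitPlane := by
  rw [argBranch_eq] at h
  exact Complex.mem_slitPlane_iff_arg.mpr ⟨by linarith, neg_ne_zero.mpr h0⟩

lemma analyticAt_logBranch {ζ : ℂ} (h : -ζ ∈ Complex.slitPlane) : AnalyticAt ℂ logBranch ζ :=
  (analyticAt_id.neg.clog h).add analyticAt_const

/-- The explicit formula consists of two functions of the type `IsModelRow`. -/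
lemma exists_rows {α β : ℂ} (hα : -(1 / 2 : ℝ) < α.re)
    (hplus : ∀ n : ℕ, α + β ≠ -((n : ℂ) + 1)) (hminus : ∀ n : ℕ, α - β ≠ -((n : ℂ) + 1)) :
    ∃ f g : Fin 2 → ℂ → ℂ, (∀ i, IsModelRow α β (f i) (g i)) ∧
      ∀ ζ ≠ 0, ∀ i, psiOne α β ζ i 0 = f i (logBranch ζ) ∧ psiOne α β ζ i 1 = g i (logBranch ζ) := by
  -- The excluded values of `α ± β` are the poles of these two factors, which have to cancel their
  -- reciprocals in the rows.
  have hG1 : Complex.Gamma (1 + α - β) ≠ 0 := by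
    refine Complex.Gamma_ne_zero fun n hn => hminus n ?_
    linear_combination hn
  have hG2 : Complex.Gamma (1 + α + β) ≠ 0 := by
    refine Complex.Gamma_ne_zero fun n hn => hplus n ?_
    linear_combination hn
  have r1 := isModelRow_tricomi hα (β := β) (expPi β * Complex.Gamma (1 + α - β)) (a := α + β)
    (by rw [mul_add])
  -- The second row, brought from second parameter `1 - 2α` to `1 + 2α` by `tricomi_symm`, has `a =
  -- 1 + α + β`; the added `1` does not change `e^(2πia)`.
  have r2 := isModelRow_tricomi hα (β := β) (Complex.Gamma (1 + α + β) * expPi (-(4 * α)))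
    (a := 1 + α + β) (by
      rw [show 2 * (1 + α + β) = (2 * α + 2 * β) + 2 * 1 by ring, expPi_add, expPi_two_mul 1,
        expPi_one]
      norm_num)
  set K₁ := expPi β * Complex.Gamma (1 + α - β)
  set K₂ := Complex.Gamma (1 + α + β) * expPi (-(4 * α))
  refine ⟨![modelRowLeft α (α + β) K₁, modelRowLeft α (1 + α + β) K₂],
    ![modelRowRight α β (α + β) K₁, modelRowRight α β (1 + α + β) K₂], fun i => ?_,
    fun ζ hζ i => ?_⟩
  · fin_cases i
    · exact r1
    · exact r2
  have hw := exp_logBranch hζ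
  have hG1' := mul_inv_cancel₀ hG1
  have hG2' := mul_inv_cancel₀ hG2
  have e1 : 1 + 2 * α - (α + β) = 1 + α - β := by ring
  have e2 : 1 + 2 * α - (1 + α + β) = α - β := by ring
  fin_cases i
  · constructor
    · have h1 : expPi β * expPi (α + β) = expPi (2 * β + α) := by
        rw [← expPi_add]
        ring_nf
      simp only [psiOne, modelRowLeft, hw, e1, K₁, rGamma, powBranch, Matrix.of_apply,
        Matrix.cons_val', Matrix.cons_val_zero, Fin.zero_eta]
      rw [← h1]
      linear_combination (-expPi β * expPi (α + β) * Complex.exp (α * logBranch ζ)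
        * Complex.exp (-ζ / 2) * tricomi (α + β) (1 + 2 * α) (logBranch ζ)) * hG1'
    · have h1 : expPi β * expPi (-(β - 2 * α) - (1 + α - β)) = -expPi (β + α) := by
        rw [← expPi_add, show β + (-(β - 2 * α) - (1 + α - β)) = (β + α) - 1 by ring, expPi_sub,
          expPi_one]
        norm_num
      simp only [psiOne, modelRowRight, hw, e1, K₁, rGamma, powBranch, Matrix.of_apply,
        Matrix.cons_val', Matrix.cons_val_zero, Matrix.cons_val_one, Fin.zero_eta]
      rw [div_eq_mul_inv (Complex.Gamma _)]
      linear_combination (-Complex.exp (α * logBranch ζ) * Complex.exp (ζ / 2)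
        * Complex.Gamma (1 + α - β) * (Complex.Gamma (α + β))⁻¹
        * tricomi (1 + α - β) (1 + 2 * α) (logBranch ζ - Real.pi * Complex.I)) * h1
  · have hp : Complex.exp (-α * logBranch ζ) * Complex.exp (2 * α * logBranch ζ)
        = Complex.exp (α * logBranch ζ) := by
      rw [← Complex.exp_add]
      ring_nf
    constructor
    · have h1 : expPi (-(4 * α)) * expPi (1 + α + β) = -expPi (β - 3 * α) := by
        rw [← expPi_add, show -(4 * α) + (1 + α + β) = (β - 3 * α) + 1 by ring, expPi_add,
          expPi_one]
        ring
      have ht := tricomi_symm (1 + α + β) (1 + 2 * α) (logBranch ζ)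
      rw [show 1 + (1 + α + β) - (1 + 2 * α) = 1 - α + β by ring,
        show 2 - (1 + 2 * α) = 1 - 2 * α by ring, add_sub_cancel_left] at ht
      simp only [psiOne, modelRowLeft, hw, e2, K₂, rGamma, powBranch, Matrix.of_apply,
        Matrix.cons_val', Matrix.cons_val_zero, Matrix.cons_val_one, Fin.mk_one]
      rw [ht, div_eq_mul_inv (Complex.Gamma _), ← hp]
      linear_combination (-Complex.exp (-α * logBranch ζ) * Complex.exp (2 * α * logBranch ζ)
        * Complex.exp (-ζ / 2) * Complex.Gamma (1 + α + β) * (Complex.Gamma (α - β))⁻¹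
        * tricomi (1 + α + β) (1 + 2 * α) (logBranch ζ)) * h1
    · have h1 : expPi (-(4 * α)) * expPi (-(β - 2 * α) - (α - β)) * Complex.exp
          (2 * α * (Real.pi * Complex.I)) = expPi (-α) := by
        rw [← expPi_add, expPi, expPi, ← Complex.exp_add]
        ring_nf
      have h2 : Complex.exp (2 * α * (logBranch ζ - Real.pi * Complex.I))
          * Complex.exp (2 * α * (Real.pi * Complex.I)) = Complex.exp (2 * α * logBranch ζ) := by
        rw [← Complex.exp_add]
        ring_nf
      have ht := tricomi_symm (α - β) (1 + 2 * α) (logBranch ζ - Real.pi * Complex.I)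
      rw [show 1 + (α - β) - (1 + 2 * α) = -α - β by ring,
        show 2 - (1 + 2 * α) = 1 - 2 * α by ring, add_sub_cancel_left] at ht
      simp only [psiOne, modelRowRight, hw, e2, K₂, rGamma, powBranch, Matrix.of_apply,
        Matrix.cons_val', Matrix.cons_val_zero, Matrix.cons_val_one, Fin.mk_one]
      rw [ht, ← hp, ← h2, ← h1]
      linear_combination (-Complex.exp (-α * logBranch ζ)
        * Complex.exp (2 * α * (logBranch ζ - Real.pi * Complex.I))
        * Complex.exp (2 * α * (Real.pi * Complex.I)) * expPi (-(4 * α))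
        * expPi (-(β - 2 * α) - (α - β)) * Complex.exp (ζ / 2)
        * tricomi (α - β) (1 + 2 * α) (logBranch ζ - Real.pi * Complex.I)) * hG2'

/-! ### Constant matrices -/

lemma det_jump (α β : ℂ) (k : Ray) : (jump α β k).det = 1 := by
  have hα := expPi_ne_zero α
  have hβ := expPi_ne_zero β
  cases k <;> simp [jump, Matrix.det_fin_two_of, expPi_neg, hα, hβ]

lemma isUnit_det_jump (α β : ℂ) (k : Ray) : IsUnit (jump α β k).det := by
  rw [det_jump]
  exact isUnit_one

lemma jump_inv (α β : ℂ) (k : Ray) : (jump α β k)⁻¹ = (jump α β k).adjugate := by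
  rw [Matrix.inv_def, det_jump, Ring.inverse_one, one_smul]

lemma matrix_fin_two_congr {a b c d a' b' c' d' : ℂ} (ha : a = a') (hb : b = b') (hc : c = c')
    (hd : d = d') : !![a, b; c, d] = !![a', b'; c', d'] := by
  rw [ha, hb, hc, hd]

lemma fromSectorOne_II (α β : ℂ) :
    fromSectorOne α β .II = !![1, 0; expPi (β - 2 * α), 1] := rfl

lemma fromSectorOne_III (α β : ℂ) :
    fromSectorOne α β .III = !![expPi α, 0; expPi α * expPi (β - 2 * α), expPi (-α)] := by
  simp [fromSectorOne, jump, mul_comm]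

lemma fromSectorOne_VI (α β : ℂ) :
    fromSectorOne α β .VI = !![expPi (-α), -expPi (α + β);
      expPi (-α) * expPi (β - 2 * α), expPi α - expPi (α + β) * expPi (β - 2 * α)] := by
  have h3 := fromSectorOne_III α β
  have hα := expPi_ne_zero α
  have hβ := expPi_ne_zero β
  simp only [fromSectorOne] at h3 ⊢
  rw [h3, jump_inv, jump_inv, jump_inv]
  simp only [jump, Matrix.adjugate_fin_two_of, Matrix.mul_fin_two, expPi_neg, expPi_add,
    expPi_sub, expPi_two_mul]
  refine matrix_fin_two_congr ?_ ?_ ?_ ?_ <;> field_simp <;> ring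

lemma fromSectorOne_VII (α β : ℂ) :
    fromSectorOne α β .VII = !![expPi (2 * α), -expPi (-β);
      expPi (2 * α) * expPi (β - 2 * α), 0] := by
  have hα := expPi_ne_zero α
  have hβ := expPi_ne_zero β
  rw [fromSectorOne, jump_inv, jump_inv]
  simp only [jump, Matrix.adjugate_fin_two_of, Matrix.mul_fin_two, expPi_neg, expPi_add,
    expPi_sub, expPi_two_mul]
  refine matrix_fin_two_congr ?_ ?_ ?_ ?_ <;> field_simp <;> ring

/-- Outside the lenses, the first column is a multiple of `f + exp(iπ(β-2α)) g`. -/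
lemma exists_fromSectorOne_mul_fromOutside (α β : ℂ) (s : Sector) :
    ∃ u v y : ℂ, fromSectorOne α β s * fromOutside α β s
      = !![u, v; u * expPi (β - 2 * α), y] := by
  have hII : ∃ u v y : ℂ, fromSectorOne α β .II = !![u, v; u * expPi (β - 2 * α), y] :=
    ⟨1, 0, 1, by rw [fromSectorOne_II, one_mul]⟩
  have hIII : ∃ u v y : ℂ, fromSectorOne α β .III = !![u, v; u * expPi (β - 2 * α), y] :=
    ⟨_, _, _, fromSectorOne_III α β⟩
  have hVI : ∃ u v y : ℂ, fromSectorOne α β .VI = !![u, v; u * expPi (β - 2 * α), y] :=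
    ⟨_, _, _, fromSectorOne_VI α β⟩
  have hVII : ∃ u v y : ℂ, fromSectorOne α β .VII = !![u, v; u * expPi (β - 2 * α), y] :=
    ⟨_, _, _, fromSectorOne_VII α β⟩
  -- In I, IV, V and VIII the factor `fromOutside` leads to the matrix of the neighbouring sector
  -- outside the lenses, so four sectors suffice.
  cases s
  · simpa only [fromSectorOne, fromOutside, one_mul] using hII
  · simpa only [fromOutside, mul_one] using hII
  · simpa only [fromOutside, mul_one] using hIII
  · simpa only [fromSectorOne, fromOutside,
      Matrix.nonsing_inv_mul_cancel_right _ _ (isUnit_det_jump α β .r4)] using hIII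
  · simpa only [fromSectorOne, fromOutside] using hVI
  · simpa only [fromOutside, mul_one] using hVI
  · simpa only [fromOutside, mul_one] using hVII
  · simpa only [fromSectorOne, fromOutside] using hVII

/-- Compatibility of the constant factors away from the positive half-axis. -/
lemma fromSectorOne_plusSide (α β : ℂ) {k : Ray} (hk : k ≠ .r7) :
    fromSectorOne α β (plusSide k) = fromSectorOne α β (minusSide k) * jump α β k := by
  have h := isUnit_det_jump α β
  cases k <;>
    simp only [fromSectorOne, plusSide, minusSide, one_mul,
      Matrix.nonsing_inv_mul _ (h _), Matrix.nonsing_inv_mul_cancel_right _ _ (h _)]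
  exact absurd rfl hk

/-! ### Sectors and rays -/

lemma sectorOf_eq {D : Directions} {s : Sector} {ζ : ℂ} (h : ζ ∈ sectorSet D s) :
    sectorOf D ζ = s := by
  obtain ⟨-, h1, h2⟩ := h
  obtain ⟨h8, h8'⟩ := D.h8
  obtain ⟨hh2, h2'⟩ := D.h2
  obtain ⟨h4, h4'⟩ := D.h4
  obtain ⟨h6, h6'⟩ := D.h6
  cases s <;> simp only [sectorBounds] at h1 h2 <;> unfold sectorOf <;> split_ifs <;>
    first | rfl | (exfalso; linarith)

lemma sectorBounds_snd_le (D : Directions) (s : Sector) :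
    (sectorBounds D s).2 ≤ 2 * Real.pi := by
  obtain ⟨h8, h8'⟩ := D.h8
  obtain ⟨hh2, h2'⟩ := D.h2
  obtain ⟨h4, h4'⟩ := D.h4
  obtain ⟨h6, h6'⟩ := D.h6
  cases s <;> simp only [sectorBounds] <;> linarith

lemma neg_mem_slitPlane_of_mem_sectorSet {D : Directions} {s : Sector} {ζ : ℂ}
    (h : ζ ∈ sectorSet D s) : -ζ ∈ Complex.slitPlane :=
  neg_mem_slitPlane h.1 (h.2.2.trans_le (sectorBounds_snd_le D s))

lemma isOpen_sectorSet (D : Directions) (s : Sector) : IsOpen (sectorSet D s) := by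
  rw [isOpen_iff_mem_nhds]
  intro ζ h
  have hc : ContinuousAt argBranch ζ :=
    Complex.continuous_im.continuousAt.comp
      (analyticAt_logBranch (neg_mem_slitPlane_of_mem_sectorSet h)).continuousAt
  filter_upwards [isOpen_ne.mem_nhds h.1, hc.eventually_const_lt h.2.1,
    hc.eventually_lt_const h.2.2] with z h0 h1 h2
  exact ⟨h0, h1, h2⟩

lemma mem_raySet_of_argBranch_eq {D : Directions} {k : Ray} {ζ : ℂ} (h0 : ζ ≠ 0)
    (h : argBranch ζ = rayAngle D k) : ζ ∈ raySet D k := by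
  refine ⟨‖ζ‖, norm_pos_iff.mpr h0, ?_⟩
  conv_lhs => rw [← exp_logBranch h0, ← Complex.re_add_im (logBranch ζ), Complex.exp_add]
  rw [logBranch_re, ← Complex.ofReal_exp, Real.exp_log (norm_pos_iff.mpr h0), ← h]
  rfl

lemma exists_mem_sectorSet {D : Directions} {ζ : ℂ} (h : ζ ∈ (contour D)ᶜ) :
    ∃ s, ζ ∈ sectorSet D s := by
  simp only [contour, Set.mem_compl_iff, Set.mem_union, Set.mem_singleton_iff, Set.mem_iUnion,
    not_or, not_exists] at h
  obtain ⟨h0, hr⟩ := h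
  have hne : ∀ k, argBranch ζ ≠ rayAngle D k := fun k hk => hr k (mem_raySet_of_argBranch_eq h0 hk)
  have hpos := argBranch_pos ζ
  -- On `Γ₇` the branch gives the argument `2π`, whereas `rayAngle` is `0`, so this ray is excluded
  -- separately.
  have hlt : argBranch ζ < 2 * Real.pi := by
    refine lt_of_le_of_ne (argBranch_le ζ) fun h => hr .r7 ?_
    refine ⟨‖ζ‖, norm_pos_iff.mpr h0, ?_⟩
    conv_lhs => rw [← exp_logBranch h0, ← Complex.re_add_im (logBranch ζ), Complex.exp_add]
    rw [logBranch_re, ← Complex.ofReal_exp, Real.exp_log (norm_pos_iff.mpr h0),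
      show (logBranch ζ).im = 2 * Real.pi from h]
    simp [rayAngle]
  have h1 := hne .r1
  have h2 := hne .r2
  have h3 := hne .r3
  have h4 := hne .r4
  have h5 := hne .r5
  have h6 := hne .r6
  have h8 := hne .r8
  simp only [rayAngle] at h1 h2 h3 h4 h5 h6 h8
  rcases lt_or_gt_of_ne h8 with a8 | a8
  · exact ⟨.VII, h0, hpos, a8⟩
  rcases lt_or_gt_of_ne h1 with a1 | a1
  · exact ⟨.VIII, h0, a8, a1⟩
  rcases lt_or_gt_of_ne h2 with a2 | a2
  · exact ⟨.I, h0, a1, a2⟩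
  rcases lt_or_gt_of_ne h3 with a3 | a3
  · exact ⟨.II, h0, a2, a3⟩
  rcases lt_or_gt_of_ne h4 with a4 | a4
  · exact ⟨.III, h0, a3, a4⟩
  rcases lt_or_gt_of_ne h5 with a5 | a5
  · exact ⟨.IV, h0, a4, a5⟩
  rcases lt_or_gt_of_ne h6 with a6 | a6
  · exact ⟨.V, h0, a5, a6⟩
  · exact ⟨.VI, h0, a6, hlt⟩

/-- The cut of the branch is `Γ₇` alone: on the other rays `-ζ` has argument `rayAngle D k - π`,
strictly between `-π` and `π`. -/
lemma neg_mem_slitPlane_of_mem_raySet {D : Directions} {k : Ray} (hk : k ≠ .r7) {ζ : ℂ}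
    (h : ζ ∈ raySet D k) : -ζ ∈ Complex.slitPlane := by
  obtain ⟨r, hr, rfl⟩ := h
  obtain ⟨h8, h8'⟩ := D.h8
  obtain ⟨hh2, h2'⟩ := D.h2
  obtain ⟨h4, h4'⟩ := D.h4
  obtain ⟨h6, h6'⟩ := D.h6
  have hθ : 0 < rayAngle D k ∧ rayAngle D k < 2 * Real.pi := by
    have := Real.pi_pos
    cases k <;> simp only [rayAngle] <;> first | exact absurd rfl hk | constructor <;> linarith
  have harg : Complex.arg (r * Complex.exp ((rayAngle D k - Real.pi : ℝ) * Complex.I))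
      = rayAngle D k - Real.pi := by
    rw [Complex.exp_mul_I]
    exact Complex.arg_mul_cos_add_sin_mul_I hr ⟨by linarith, by linarith⟩
  have heq : -(r * Complex.exp (rayAngle D k * Complex.I))
      = r * Complex.exp ((rayAngle D k - Real.pi : ℝ) * Complex.I) := by
    push_cast
    rw [sub_mul, Complex.exp_sub_pi_mul_I]
    ring
  rw [heq, Complex.mem_slitPlane_iff_arg, harg]
  refine ⟨by linarith, mul_ne_zero ?_ (Complex.exp_ne_zero _)⟩
  exact_mod_cast hr.ne'

/-- From sector VII, `-ζ` approaches the negative axis from below, where the principal logarithm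
tends to `log r - iπ`. From sector VI it approaches from above, and the two limits differ by `2πi`.
-/
lemma tendsto_logBranch_above (D : Directions) {r : ℝ} (hr : 0 < r) :
    Tendsto logBranch (𝓝[sectorSet D .VII] (r : ℂ)) (𝓝 (Real.log r : ℂ)) := by
  have h1 := Complex.tendsto_log_nhdsWithin_im_neg_of_re_neg_of_im_zero (z := -(r : ℂ))
    (by simpa using hr) (by simp)
  have h2 : Tendsto (fun ζ : ℂ => -ζ) (𝓝[sectorSet D .VII] (r : ℂ)) (𝓝[{z | z.im < 0}] (-(r : ℂ))) := by
    refine tendsto_nhdsWithin_iff.mpr ⟨continuous_neg.continuousAt.mono_left nhdsWithin_le_nhds, ?_⟩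
    filter_upwards [self_mem_nhdsWithin] with ζ hζ
    refine Complex.arg_neg_iff.mp ?_
    have h3 := hζ.2.2
    rw [argBranch_eq] at h3
    simp only [sectorBounds] at h3
    linarith [D.h8.2, Real.pi_pos]
  have h3 := (h1.comp h2).add_const (Real.pi * Complex.I)
  have h4 : ‖-(r : ℂ)‖ = r := by simp [abs_of_pos hr]
  rw [h4, sub_add_cancel] at h3
  exact h3

lemma tendsto_logBranch_below (D : Directions) {r : ℝ} (hr : 0 < r) :
    Tendsto logBranch (𝓝[sectorSet D .VI] (r : ℂ))
      (𝓝 ((Real.log r : ℂ) + 2 * Real.pi * Complex.I)) := by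
  have h1 := Complex.tendsto_log_nhdsWithin_im_nonneg_of_re_neg_of_im_zero (z := -(r : ℂ))
    (by simpa using hr) (by simp)
  have h2 : Tendsto (fun ζ : ℂ => -ζ) (𝓝[sectorSet D .VI] (r : ℂ)) (𝓝[{z | 0 ≤ z.im}] (-(r : ℂ))) := by
    refine tendsto_nhdsWithin_iff.mpr ⟨continuous_neg.continuousAt.mono_left nhdsWithin_le_nhds, ?_⟩
    filter_upwards [self_mem_nhdsWithin] with ζ hζ
    refine Complex.arg_nonneg_iff.mp ?_
    have h3 := hζ.2.1
    rw [argBranch_eq] at h3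
    simp only [sectorBounds] at h3
    linarith [D.h6.1, Real.pi_pos]
  have h3 := (h1.comp h2).add_const (Real.pi * Complex.I)
  have h4 : ‖-(r : ℂ)‖ = r := by simp [abs_of_pos hr]
  rw [h4, add_assoc, ← two_mul, ← mul_assoc] at h3
  exact h3

lemma tendsto_logBranch_originFilter (D : Directions) (s : Sector) :
    Tendsto logBranch (𝓝[sectorSet D s] 0) originFilter := by
  refine tendsto_inf.mpr ⟨tendsto_comap_iff.mpr ?_, tendsto_principal.mpr ?_⟩
  · have h1 : Tendsto (fun ζ : ℂ => ‖ζ‖) (𝓝[sectorSet D s] 0) (𝓝[≠] 0) := by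
      refine tendsto_nhdsWithin_iff.mpr ⟨?_, ?_⟩
      · simpa using (continuous_norm.tendsto (0 : ℂ)).mono_left nhdsWithin_le_nhds
      · filter_upwards [self_mem_nhdsWithin] with ζ hζ
        exact norm_ne_zero_iff.mpr hζ.1
    refine (Real.tendsto_log_nhdsNE_zero.comp h1).congr fun ζ => ?_
    exact (logBranch_re ζ).symm
  · refine Eventually.of_forall fun ζ => ?_
    exact abs_le.mpr ⟨by linarith [argBranch_pos ζ, Real.pi_pos, show argBranch ζ = _ from rfl],
      argBranch_le ζ⟩

/-! ### The Riemann–Hilbert problem -/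

theorem isModelSolution_modelPsi (D : Directions) {α β : ℂ} (hα : -(1 / 2 : ℝ) < α.re)
    (hplus : ∀ n : ℕ, α + β ≠ -((n : ℂ) + 1)) (hminus : ∀ n : ℕ, α - β ≠ -((n : ℂ) + 1)) :
    IsModelSolution D α β (modelPsi D α β) := by
  obtain ⟨f, g, hrow, hpsi⟩ := exists_rows hα hplus hminus
  have hf : ∀ i, Differentiable ℂ (f i) := fun i => (hrow i).form_left.differentiable
  have hg : ∀ i, Differentiable ℂ (g i) := fun i => (hrow i).form_right.differentiable
  have hmul : ∀ ζ ≠ 0, ∀ (T : Matrix (Fin 2) (Fin 2) ℂ) (i j : Fin 2),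
      (psiOne α β ζ * T) i j = f i (logBranch ζ) * T 0 j + g i (logBranch ζ) * T 1 j := by
    intro ζ hζ T i j
    rw [Matrix.mul_apply, Fin.sum_univ_two, (hpsi ζ hζ i).1, (hpsi ζ hζ i).2]
  have hsec : ∀ s, ∀ ζ ∈ sectorSet D s,
      modelPsi D α β ζ = psiOne α β ζ * fromSectorOne α β s := by
    intro s ζ hζ
    rw [modelPsi, sectorOf_eq hζ]
  have hlim : ∀ (s : Sector) (ζ₀ w₀ : ℂ), Tendsto logBranch (𝓝[sectorSet D s] ζ₀) (𝓝 w₀) →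
      Tendsto (modelPsi D α β) (𝓝[sectorSet D s] ζ₀)
        (𝓝 (!![f 0 w₀, g 0 w₀; f 1 w₀, g 1 w₀] * fromSectorOne α β s)) := by
    intro s ζ₀ w₀ h
    refine tendsto_pi_nhds.mpr fun i => tendsto_pi_nhds.mpr fun j => ?_
    have h1 := ((((hf i).continuous.tendsto w₀).comp h).mul_const (fromSectorOne α β s 0 j)).add
      ((((hg i).continuous.tendsto w₀).comp h).mul_const (fromSectorOne α β s 1 j))
    have h2 : (!![f 0 w₀, g 0 w₀; f 1 w₀, g 1 w₀] * fromSectorOne α β s) i j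
        = f i w₀ * fromSectorOne α β s 0 j + g i w₀ * fromSectorOne α β s 1 j := by
      rw [Matrix.mul_apply, Fin.sum_univ_two]
      fin_cases i <;> rfl
    rw [h2]
    refine h1.congr' ?_
    filter_upwards [self_mem_nhdsWithin] with ζ hζ
    rw [hsec s ζ hζ, hmul ζ hζ.1]
    rfl
  have hout : ∀ s, ∃ u v y : ℂ, ∀ ζ ∈ sectorSet D s, ∀ i,
      (modelPsi D α β ζ * fromOutside α β s) i 0
        = u * (f i (logBranch ζ) + expPi (β - 2 * α) * g i (logBranch ζ)) ∧
      (modelPsi D α β ζ * fromOutside α β s) i 1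
        = v * f i (logBranch ζ) + y * g i (logBranch ζ) := by
    intro s
    obtain ⟨u, v, y, h⟩ := exists_fromSectorOne_mul_fromOutside α β s
    refine ⟨u, v, y, fun ζ hζ i => ?_⟩
    rw [hsec s ζ hζ, Matrix.mul_assoc, h, hmul ζ hζ.1, hmul ζ hζ.1]
    constructor <;> simp <;> ring
  have horig := tendsto_logBranch_originFilter D
  refine ⟨fun i j ζ hζ => ?_, fun k ζ₀ hζ₀ => ?_, fun hα0 s i => ?_, fun hα0 _ s i => ?_⟩
  · obtain ⟨s, hs⟩ := exists_mem_sectorSet hζ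
    have hl := analyticAt_logBranch (neg_mem_slitPlane_of_mem_sectorSet hs)
    have h := ((((hf i).analyticAt _).comp hl).mul
      (analyticAt_const (v := fromSectorOne α β s 0 j))).add
      ((((hg i).analyticAt _).comp hl).mul (analyticAt_const (v := fromSectorOne α β s 1 j)))
    refine h.congr ?_
    filter_upwards [(isOpen_sectorSet D s).mem_nhds hs] with z hz
    rw [hsec s z hz, hmul z hz.1]
    rfl
  · by_cases hk : k = .r7
    · subst hk
      obtain ⟨r, hr, rfl⟩ := hζ₀
      have h0 : (r : ℂ) * Complex.exp (rayAngle D .r7 * Complex.I) = r := by simp [rayAngle]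
      rw [h0]
      refine ⟨_, _, hlim .VII _ _ (tendsto_logBranch_above D hr),
        hlim .VI _ _ (tendsto_logBranch_below D hr), ?_⟩
      rw [Matrix.mul_assoc, fromSectorOne_VII, fromSectorOne_VI]
      have hα' := expPi_ne_zero α
      have hβ' := expPi_ne_zero β
      -- The values at `log r + 2πi` are expressed through those at `log r`: the second monodromy
      -- relation gives `g`, and subtracting its multiple from the first gives `f`. The jump on `Γ₇`
      -- is then an identity between exponentials.
      have key : ∀ i, ∃ m, m = f i (Real.log r) + expPi (β - 2 * α) * g i (Real.log r) ∧
          g i (Real.log r + 2 * Real.pi * Complex.I)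
            = expPi (β + 2 * α) * m - expPi (-β) * f i (Real.log r) ∧
          f i (Real.log r + 2 * Real.pi * Complex.I)
            = expPi (2 * α) * m - expPi (β - 2 * α)
              * (expPi (β + 2 * α) * m - expPi (-β) * f i (Real.log r)) := by
        intro i
        refine ⟨_, rfl, (hrow i).monodromy_right _, ?_⟩
        rw [← (hrow i).monodromy_right, ← (hrow i).monodromy_sum]
        ring
      obtain ⟨m₀, hm₀, hg₀, hf₀⟩ := key 0
      obtain ⟨m₁, hm₁, hg₁, hf₁⟩ := key 1
      rw [hg₀, hf₀, hg₁, hf₁]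
      simp only [jump, Matrix.mul_fin_two, hm₀, hm₁, expPi_neg, expPi_add, expPi_sub,
        expPi_two_mul]
      refine matrix_fin_two_congr ?_ ?_ ?_ ?_ <;> field_simp <;> ring
    · have hl := (analyticAt_logBranch (neg_mem_slitPlane_of_mem_raySet hk hζ₀)).continuousAt
      refine ⟨_, _, hlim (plusSide k) ζ₀ _ (hl.tendsto.mono_left nhdsWithin_le_nhds),
        hlim (minusSide k) ζ₀ _ (hl.tendsto.mono_left nhdsWithin_le_nhds), ?_⟩
      rw [Matrix.mul_assoc, fromSectorOne_plusSide α β hk]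
  · obtain ⟨u, v, y, h⟩ := hout s
    have hmem := self_mem_nhdsWithin (a := (0 : ℂ)) (s := sectorSet D s)
    constructor
    · refine (((hrow i).isBigO_sum.comp_tendsto (horig s)).const_mul_left u).congr' ?_ EventuallyEq.rfl
      filter_upwards [hmem] with ζ hζ
      exact ((h ζ hζ i).1).symm
    · refine ((((hrow i).form_left.isBigO hα0).comp_tendsto (horig s)).const_mul_left v |>.add
        ((((hrow i).form_right.isBigO hα0).comp_tendsto (horig s)).const_mul_left y)).congr' ?_
          EventuallyEq.rfl
      filter_upwards [hmem] with ζ hζ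
      exact ((h ζ hζ i).2).symm
  · subst hα0
    obtain ⟨u, v, y, h⟩ := hout s
    have hmem := self_mem_nhdsWithin (a := (0 : ℂ)) (s := sectorSet D s)
    constructor
    · refine IsBigO.congr' (((hrow i).isBigO_sum.comp_tendsto (horig s)).const_mul_left u).norm_right
        ?_ (Eventually.of_forall fun ζ => ?_)
      · filter_upwards [hmem] with ζ hζ
        exact ((h ζ hζ i).1).symm
      · simp
    · refine ((((hrow i).form_left.isBigO_log).comp_tendsto (horig s)).const_mul_left v |>.add
        ((((hrow i).form_right.isBigO_log).comp_tendsto (horig s)).const_mul_left y)).congr' ?_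
          (Eventually.of_forall fun ζ => logBranch_re ζ)
      filter_upwards [hmem] with ζ hζ
      exact ((h ζ hζ i).2).symm

end FisherHartwig

end

theorem proposition4p1 (D : FisherHartwig.Directions) (α β : ℂ)
    (hα : -(1 / 2 : ℝ) < α.re)
    (hplus : ∀ n : ℕ, α + β ≠ -((n : ℂ) + 1))
    (hminus : ∀ n : ℕ, α - β ≠ -((n : ℂ) + 1)) :
    FisherHartwig.IsModelSolution D α β (FisherHartwig.modelPsi D α β) :=
  FisherHartwig.isModelSolution_modelPsi D hα hplus hminus
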